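/- A matroid $M$ (on a finite ground set) is called paving if every circuit of $M$ has cardinality at least the rank of $M$, and sparse paving if both $M$ and its dual $M^*$ are paving. For $n\in\mathbb{N}$, let $m'_n$ be the number of matroids with ground set $[n]=\{1,\dots,n\}$ that have neither loops nor coloops, and let $s_n$ be the number of sparse paving matroids with ground set $[n]$ (in both cases counting labelled matroids, not isomorphism classes). Theorem. $\log_2 m'_n \le (1+o(1))\,\log_2 s_n$ as $n\to\infty$; that is, there is a sequence of real numbers $\varepsilon_n\to 0$ such that $\log_2 m'_n\le (1+\varepsilon_n)\log_2 s_n$ for all sufficiently large $n$. -/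

import Mathlib

open Filter Topology

/-- A matroid is paving if each of its circuits has cardinality at least its rank. -/
def Matroid.IsPaving {α : Type*} (M : Matroid α) : Prop :=
  ∀ C : Set α, M.IsCircuit C → M.eRank ≤ C.encard

/-- A matroid is sparse paving if both it and its dual are paving. -/
def Matroid.IsSparsePaving {α : Type*} (M : Matroid α) : Prop :=
  M.IsPaving ∧ M✶.IsPaving

/-- The set of all matroids whose ground set is the full `n`-element set `Fin n`. -/
def matroidsOn (n : ℕ) : Set (Matroid (Fin n)) :=
  {M | M.E = Set.univ}

/-- There are finitely many matroids on a finite type, so the cardinalities below are genuine. -/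
theorem matroid_finite (n : ℕ) : Finite (Matroid (Fin n)) := by
  refine Finite.of_injective
    (fun M : Matroid (Fin n) => ((M.E, {B | M.IsBase B}) : Set (Fin n) × Set (Set (Fin n)))) ?_
  intro M N h
  simp only [Prod.mk.injEq] at h
  exact Matroid.ext_isBase h.1 (fun B _ => Set.ext_iff.mp h.2 B)

/-- The number `m'_n` of matroids on an `n`-element ground set without loops and coloops. -/
noncomputable def numLooplessColoopless (n : ℕ) : ℕ :=
  Set.ncard {M ∈ matroidsOn n | (∀ e, ¬ M.IsLoop e) ∧ (∀ e, ¬ M.IsColoop e)}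

/-- The number `s_n` of sparse paving matroids on an `n`-element ground set. -/
noncomputable def numSparsePaving (n : ℕ) : ℕ :=
  Set.ncard {M ∈ matroidsOn n | M.IsSparsePaving}

/-!
The non-bases of a matroid `M` of rank `r` on `n` elements form a family `K` of vertices of the
Johnson graph of `r`-sets, and for `0 < r < n` the `r`-sets outside a stable set of this graph
are the bases of a sparse paving matroid (`Stable.exists_sparsePaving`). The matroid `M` is
encoded by its rank, a stable set, and a small amount of further information; loops and coloops
play no role.

Near a set `X ∈ K` of rank `r - 1` the family `K` is governed by one circuit and one hyperplane
(`exists_localCover`): a neighbour `X - e + f` is a non-basis if and only if `e` avoids the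
circuit contained in `X` or `f` lies in the hyperplane spanned by `X`. If `X` has smaller rank,
all its neighbours are non-bases. So two pairs `(F, k)`, where the set `F` has rank at most `k`,
certify all non-bases among `X` and its neighbours. Greedy domination (`exists_cover`) yields `O
(N * log n / n ^ 2)` such certificates, with `N` the central binomial coefficient, for which
every uncovered member of `K` has at most half of the possible neighbours in `K`, and only few
uncovered neighbours. The bound on their number rests on the partition of the edges of the
Johnson graph into cliques, which forces large degrees in every family much larger than `N / n`
(`exists_large_deg`).

Now let `I` be a maximal stable set of uncovered non-bases. For `Y ∈ I` the element `f` lies in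
the hyperplane spanned by `Y` exactly when more than half of the sets `Y - e + f`, for `e ∈ Y`,
are covered, and the circuit in `Y` is recognised dually (`swap_mem_iff_of_covered`). Since each
uncovered non-basis outside `I` is a neighbour of some `Y ∈ I`, the certificates and `I`
determine `K` (`exists_eq_decode`).

There are only about `N * n ^ 2` certificates in total, so a choice of `O (N * log n / n ^ 2)`
of them costs `O (N * (log n) ^ 2 / n ^ 2)` bits, and there are at most `s_n` choices for `I`.
Ranks outside `[n / 4, 3 * n / 4]` contribute little because there are few `r`-sets. Finally
`log s_n` is at least of order `N / n`, as the sets with a given element sum modulo `n` are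
stable (`exists_large_stable`), so that all errors are negligible.
-/

namespace MatroidCount

open Finset

/-! ### Certificates and the local structure of the non-bases -/

variable {α : Type*}

section Nonbases

variable [Fintype α]

open Classical in
/-- The non-bases of cardinality `r` of `M`. -/
noncomputable def nonbases (M : Matroid α) (r : ℕ) : Finset (Finset α) :=
  {X ∈ powersetCard r univ | ¬ M.IsBase X}

theorem mem_nonbases {M : Matroid α} {r : ℕ} {X : Finset α} :
    X ∈ nonbases M r ↔ X.card = r ∧ ¬ M.IsBase X := by
  simp [nonbases, mem_powersetCard]

theorem nonbases_subset (M : Matroid α) (r : ℕ) : nonbases M r ⊆ powersetCard r univ := fun _ h =>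
  mem_powersetCard.2 ⟨subset_univ _, (mem_nonbases.1 h).1⟩

theorem isBase_iff_indep_card {M : Matroid α} {r : ℕ} (hr : M.eRank = r) {X : Finset α} :
    M.IsBase X ↔ M.Indep X ∧ X.card = r := by
  constructor
  · intro h
    refine ⟨h.indep, ?_⟩
    have := h.encard_eq_eRank
    rw [hr, Set.encard_coe_eq_coe_finsetCard] at this
    exact_mod_cast this
  · rintro ⟨h, hc⟩
    obtain ⟨B, hB, hXB⟩ := h.exists_isBase_superset
    have hBc := hB.encard_eq_eRank
    have : (X : Set α) = B := by
      refine Set.Finite.eq_of_subset_of_encard_le (Set.toFinite _) hXB ?_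
      rw [hBc, hr, Set.encard_coe_eq_coe_finsetCard, hc]
    rwa [this]

end Nonbases

variable [DecidableEq α]

/-- The vertex `X - e + f` of the Johnson graph; it is a neighbour of `X` when `e ∈ X` and
`f ∉ X`. -/
def swap (X : Finset α) (e f : α) : Finset α := insert f (X.erase e)

/-- A certificate `(F, k)` covers `Y` if `Y` has more than `k` elements in `F`. If `F` has rank at
most `k` in a matroid, then every set covered by `(F, k)` is dependent. -/
def Covers (φ : Finset α × ℕ) (Y : Finset α) : Prop := φ.2 < (φ.1 ∩ Y).card

instance (φ : Finset α × ℕ) (Y : Finset α) : Decidable (Covers φ Y) :=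
  inferInstanceAs (Decidable (_ < _))

/-- `Y` is covered by some certificate of the family `F`. -/
def CoveredBy (F : Finset (Finset α × ℕ)) (Y : Finset α) : Prop := ∃ φ ∈ F, Covers φ Y

instance (F : Finset (Finset α × ℕ)) (Y : Finset α) : Decidable (CoveredBy F Y) :=
  inferInstanceAs (Decidable (∃ φ ∈ F, Covers φ Y))

theorem card_swap {X : Finset α} {e f : α} (he : e ∈ X) (hf : f ∉ X) :
    (swap X e f).card = X.card := by
  have h : f ∉ X.erase e := fun h => hf (mem_of_mem_erase h)
  rw [swap, card_insert_of_notMem h, card_erase_of_mem he]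
  have := card_pos.2 ⟨e, he⟩
  omega

theorem swap_swap {X : Finset α} {e f : α} (he : e ∈ X) (hf : f ∉ X) :
    swap (swap X e f) f e = X := by
  ext x
  simp only [swap, mem_insert, mem_erase]
  by_cases h1 : x = e
  · simp [h1, he]
  · by_cases h2 : x = f
    · simp [h2, hf]; rintro rfl; exact absurd he hf
    · simp [h1, h2]

theorem mem_swap {X : Finset α} {e f : α} : f ∈ swap X e f := mem_insert_self _ _

theorem notMem_swap {X : Finset α} {e f : α} (he : e ∈ X) (hf : f ∉ X) : e ∉ swap X e f := by
  have : e ≠ f := fun h => hf (h ▸ he)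
  simp [swap, this]

theorem swap_inj {X : Finset α} {e f e' f' : α} (he : e ∈ X) (hf : f ∉ X)
    (h : swap X e f = swap X e' f') : e = e' ∧ f = f' := by
  constructor
  · by_contra hne
    have h1 : e ∈ swap X e' f' := mem_insert_of_mem (mem_erase.2 ⟨hne, he⟩)
    exact notMem_swap he hf (h ▸ h1)
  · have h1 : f ∈ swap X e' f' := h ▸ mem_swap
    rcases mem_insert.1 h1 with h2 | h2
    · exact h2
    · exact absurd (mem_of_mem_erase h2) hf

section Local

variable [Fintype α]

/-- What is used about the family `K` of non-bases of a matroid of rank `r`: around `X ∈ K`, the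
members of `K` at distance one are the sets `X - e + f` with `e ∈ A` or `f ∈ B`, and the at most two
certificates in `c` cover `X` and all these sets, and only members of `K`. -/
structure LocalCover (r : ℕ) (K : Finset (Finset α)) (X A B : Finset α)
    (c : Finset (Finset α × ℕ)) : Prop where
  subset_left : A ⊆ X
  disjoint_right : Disjoint B X
  card_le : c.card ≤ 2
  subset_univ : c ⊆ univ ×ˢ range (Fintype.card α + 1)
  sound : ∀ Y : Finset α, Y.card = r → CoveredBy c Y → Y ∈ K
  self : CoveredBy c X
  swap_mem_iff : ∀ e ∈ X, ∀ f ∉ X, (swap X e f ∈ K ↔ e ∈ A ∨ f ∈ B)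
  covered : ∀ e ∈ X, ∀ f ∉ X, swap X e f ∈ K → CoveredBy c (swap X e f)

/-- If some `X - e₀` is independent, then `X` contains a unique circuit `X \ A` and spans a
hyperplane `X ∪ B`; otherwise every set sharing all but one element of `X` is dependent. -/
theorem exists_localCover (M : Matroid α) (hE : M.E = Set.univ) {r : ℕ} (hr : M.eRank = r)
    (hr2 : 2 ≤ r) {X : Finset α} (hX : X ∈ nonbases M r) :
    ∃ A B c, LocalCover r (nonbases M r) X A B c := by
  classical
  obtain ⟨hXc, hXb⟩ := mem_nonbases.1 hX
  have hXdep : ¬ M.Indep X := fun h => hXb ((isBase_iff_indep_card hr).2 ⟨h, hXc⟩)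
  have hcard : ∀ Y : Finset α, Y.card ≤ Fintype.card α := fun Y => card_le_univ Y
  by_cases hcase : ∃ e₀ ∈ X, M.Indep ((X.erase e₀ : Finset α) : Set α)
  · obtain ⟨e₀, he₀, hJ⟩ := hcase
    set A : Finset α := {e ∈ X | ¬ M.Indep ((X.erase e : Finset α) : Set α)} with hA
    set B : Finset α := {f | f ∉ X ∧ f ∈ M.closure X} with hB
    have hclJ : ∀ e ∈ X, M.Indep ((X.erase e : Finset α) : Set α) →
        M.closure ((X.erase e : Finset α) : Set α) = M.closure X := by
      intro e he hI
      refine le_antisymm (M.closure_subset_closure (by exact_mod_cast erase_subset e X)) ?_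
      refine M.closure_subset_closure_of_subset_closure ?_
      intro x hx
      by_cases hxe : x = e
      · subst hxe
        by_contra hcl
        have := (hI.notMem_closure_iff (by rw [hE]; trivial)).1 hcl
        apply hXdep
        have h2 := this.1
        rw [← Finset.coe_insert, insert_erase he] at h2
        exact h2
      · exact M.mem_closure_of_mem' (by simpa using ⟨hx, hxe⟩) (by rw [hE]; trivial)
    -- sets inside the hyperplane spanned by `X`
    have hhyp : ∀ Y : Finset α, Y.card = r → (Y : Set α) ⊆ M.closure X → ¬ M.IsBase Y := by
      intro Y hYc hY hYb
      have h1 : M.eRk Y ≤ M.eRk (M.closure X) := M.eRk_mono hY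
      rw [← hclJ e₀ he₀ hJ, M.eRk_closure_eq, hJ.eRk_eq_encard, hYb.indep.eRk_eq_encard,
        Set.encard_coe_eq_coe_finsetCard, Set.encard_coe_eq_coe_finsetCard, hYc,
        card_erase_of_mem he₀, hXc] at h1
      have : r ≤ r - 1 := by exact_mod_cast h1
      omega
    have hXAdep : ¬ M.Indep ((X \ A : Finset α) : Set α) := by
      intro hI
      obtain ⟨J, hJb, hJs⟩ := hI.subset_isBasis_of_subset (X := (X : Set α))
        (by exact_mod_cast sdiff_subset) (by rw [hE]; exact Set.subset_univ _)
      have hJb0 : M.IsBasis ((X.erase e₀ : Finset α) : Set α) (X : Set α) := by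
        refine hJ.isBasis_of_subset_of_subset_closure (by exact_mod_cast erase_subset _ _) ?_
        rw [hclJ e₀ he₀ hJ]
        exact M.subset_closure _ (by rw [hE]; exact Set.subset_univ _)
      obtain ⟨e, he, heJ⟩ : ∃ e ∈ X, e ∉ J := by
        by_contra hcon
        push Not at hcon
        exact hXdep (hJb.indep.subset fun x hx => hcon x hx)
      have hJe : J ⊆ ((X.erase e : Finset α) : Set α) := by
        intro x hx
        have := hJb.subset hx
        simp only [coe_erase, Set.mem_sdiff, mem_coe, Set.mem_singleton_iff]
        exact ⟨this, fun h => heJ (h ▸ hx)⟩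
      have henc := hJb.encard_eq_encard hJb0
      have hJeq : J = ((X.erase e : Finset α) : Set α) := by
        refine Set.Finite.eq_of_subset_of_encard_le (Set.toFinite _) hJe ?_
        rw [henc, Set.encard_coe_eq_coe_finsetCard, Set.encard_coe_eq_coe_finsetCard,
          card_erase_of_mem he, card_erase_of_mem he₀]
      have heA : e ∉ A := by
        simp only [hA, mem_filter, not_and, not_not]
        intro _
        rw [← hJeq]; exact hJb.indep
      exact heJ (hJs (by simp [he, heA]))
    have hcirc : ∀ Y : Finset α, X \ A ⊆ Y → ¬ M.IsBase Y := fun Y hY hYb =>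
      hXAdep (hYb.indep.subset (by exact_mod_cast hY))
    have hpos : 0 < (X \ A).card := by
      rw [card_pos, nonempty_iff_ne_empty]
      intro h0
      rw [h0] at hXAdep
      simp at hXAdep
    have hXB : ((X ∪ B : Finset α) : Set α) ⊆ M.closure X := by
      intro x hx
      rcases mem_union.1 (mem_coe.1 hx) with h | h
      · exact M.mem_closure_of_mem' (mem_coe.2 h) (by rw [hE]; trivial)
      · simp only [hB, mem_filter] at h
        exact h.2.2
    -- the sets covered by the two certificates
    have hcov1 : ∀ Y : Finset α, Covers (X \ A, (X \ A).card - 1) Y ↔ X \ A ⊆ Y := by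
      intro Y
      simp only [Covers]
      constructor
      · intro h
        have h1 : (X \ A).card ≤ ((X \ A) ∩ Y).card := by omega
        have h2 := eq_of_subset_of_card_le inter_subset_left h1
        exact inter_eq_left.1 h2
      · intro h
        rw [inter_eq_left.2 h]; omega
    have hcov2 : ∀ Y : Finset α, Y.card = r → (Covers (X ∪ B, r - 1) Y ↔ Y ⊆ X ∪ B) := by
      intro Y hY
      simp only [Covers]
      constructor
      · intro h
        have h1 : Y.card ≤ ((X ∪ B) ∩ Y).card := by omega
        exact inter_eq_right.1 (eq_of_subset_of_card_le inter_subset_right h1)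
      · intro h
        rw [inter_eq_right.2 h]; omega
    have hiff : ∀ e ∈ X, ∀ f ∉ X, (swap X e f ∈ nonbases M r ↔ e ∈ A ∨ f ∈ B) := by
      intro e he f hf
      rw [mem_nonbases, card_swap he hf]
      constructor
      · rintro ⟨-, hb⟩
        by_contra hcon
        push Not at hcon
        obtain ⟨h1, h2⟩ := hcon
        have hI : M.Indep ((X.erase e : Finset α) : Set α) := by
          by_contra h; exact h1 (mem_filter.2 ⟨he, h⟩)
        have hcl : f ∉ M.closure X := fun h => h2 (by simp [hB, hf, h])
        rw [← hclJ e he hI] at hcl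
        have h3 := ((hI.notMem_closure_iff (by rw [hE]; trivial)).1 hcl).1
        rw [← Finset.coe_insert] at h3
        exact hb ((isBase_iff_indep_card hr).2 ⟨h3, by rw [← hXc]; exact card_swap he hf⟩)
      · rintro (h | h)
        · refine ⟨hXc, fun hb => ?_⟩
          simp only [hA, mem_filter] at h
          exact h.2 (hb.indep.subset (by exact_mod_cast subset_insert _ _))
        · refine ⟨hXc, hhyp _ (by rw [card_swap he hf, hXc]) (subset_trans ?_ hXB)⟩
          intro x hx
          rcases mem_insert.1 (mem_coe.1 hx) with rfl | h'
          · exact mem_coe.2 (mem_union_right _ h)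
          · exact mem_coe.2 (mem_union_left _ (mem_of_mem_erase h'))
    refine ⟨A, B, {(X \ A, (X \ A).card - 1), (X ∪ B, r - 1)}, filter_subset _ _, ?_, card_le_two,
      ?_, ?_, ?_, hiff, ?_⟩
    · rw [disjoint_left]
      intro x hx
      simp only [hB, mem_filter] at hx
      exact hx.2.1
    · intro φ hφ
      have h1 := hcard (X \ A)
      have h2 := hcard X
      simp only [mem_insert, mem_singleton] at hφ
      rcases hφ with rfl | rfl <;> simp only [mem_product, mem_univ, mem_range, true_and] <;> omega
    · rintro Y hY ⟨φ, hφ, hc⟩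
      simp only [mem_insert, mem_singleton] at hφ
      rcases hφ with rfl | rfl
      · exact mem_nonbases.2 ⟨hY, hcirc Y ((hcov1 Y).1 hc)⟩
      · exact mem_nonbases.2 ⟨hY, hhyp Y hY
          (subset_trans (by exact_mod_cast (hcov2 Y hY).1 hc) hXB)⟩
    · exact ⟨_, mem_insert_self _ _, (hcov1 X).2 sdiff_subset⟩
    · intro e he f hf hK
      rcases (hiff e he f hf).1 hK with h | h
      · refine ⟨_, mem_insert_self _ _, (hcov1 _).2 ?_⟩
        intro x hx
        rw [Finset.mem_sdiff] at hx
        exact mem_insert_of_mem (mem_erase.2 ⟨fun h' => hx.2 (h' ▸ h), hx.1⟩)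
      · refine ⟨_, mem_insert_of_mem (mem_singleton_self _),
          (hcov2 _ (by rw [card_swap he hf, hXc])).2 ?_⟩
        intro x hx
        rcases mem_insert.1 hx with rfl | h'
        · exact mem_union_right _ h
        · exact mem_union_left _ (mem_of_mem_erase h')
  · -- `X` has rank at most `r - 2`, so every neighbour of `X` is dependent
    push Not at hcase
    have hdep : ∀ e ∈ X, ∀ Y : Finset α, X.erase e ⊆ Y → ¬ M.IsBase Y := fun e he Y hY hb =>
      hcase e he (hb.indep.subset (by exact_mod_cast hY))
    have hcovswap : ∀ e ∈ X, ∀ f ∉ X, Covers (X, r - 2) (swap X e f) := by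
      intro e he f hf
      have h1 : X.erase e ⊆ X ∩ swap X e f := subset_inter (erase_subset _ _) (subset_insert _ _)
      have h2 := card_le_card h1
      rw [card_erase_of_mem he] at h2
      simp only [Covers]
      omega
    refine ⟨X, ∅, {(X, r - 2)}, subset_rfl, disjoint_empty_left _, by simp, ?_, ?_, ?_, ?_, ?_⟩
    · have := hcard X
      simp only [singleton_subset_iff, mem_product, mem_univ, mem_range, true_and]
      omega
    · rintro Y hY ⟨φ, hφ, hc⟩
      rw [mem_singleton] at hφ
      subst hφ
      simp only [Covers] at hc
      refine mem_nonbases.2 ⟨hY, ?_⟩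
      have h1 : (X \ Y).card ≤ 1 := by
        have := card_sdiff_add_card_inter X Y
        omega
      obtain ⟨e, he, hsub⟩ : ∃ e ∈ X, X.erase e ⊆ Y := by
        rcases Nat.eq_zero_or_pos (X \ Y).card with h0 | h0
        · have hne : X.Nonempty := card_pos.1 (by omega)
          obtain ⟨e, he⟩ := hne
          exact ⟨e, he, (erase_subset _ _).trans (sdiff_eq_empty_iff_subset.1 (card_eq_zero.1 h0))⟩
        · obtain ⟨e, he⟩ := card_eq_one.1 (le_antisymm h1 h0)
          have heX : e ∈ X \ Y := by rw [he]; exact mem_singleton_self _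
          refine ⟨e, (Finset.mem_sdiff.1 heX).1, fun x hx => ?_⟩
          by_contra hxY
          have : x ∈ X \ Y := Finset.mem_sdiff.2 ⟨mem_of_mem_erase hx, hxY⟩
          rw [he, mem_singleton] at this
          exact (mem_erase.1 hx).1 this
      exact hdep e he Y hsub
    · exact ⟨_, mem_singleton_self _, by simp only [Covers, inter_self]; omega⟩
    · intro e he f hf
      rw [mem_nonbases, card_swap he hf]
      exact ⟨fun _ => Or.inl he, fun _ => ⟨hXc, hdep e he _ (subset_insert _ _)⟩⟩
    · exact fun e he f hf _ => ⟨_, mem_singleton_self _, hcovswap e he f hf⟩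

end Local

/-! ### Greedy domination -/

section Greedy

variable {β : Type*} [DecidableEq β] (R : β → β → Prop) [DecidableRel R]

/-- If every large part of `T` has a proportion `q` of its elements dominated by a single member of
`K`, then greedily chosen members of `K` dominate all but `m` elements of `T`. -/
theorem exists_dominating_of_proportion (K T : Finset β) {q m L : ℝ} (hq : 0 < q) (hL : 0 ≤ L)
    (hT : (T.card : ℝ) ≤ m * Real.exp L)
    (hstep : ∀ T' ⊆ T, m ≤ T'.card → ∃ v ∈ K, q * T'.card ≤ #{x ∈ T' | R v x}) :
    ∃ S ⊆ K, (S.card : ℝ) ≤ L / q + 1 ∧ (#{x ∈ T | ¬ ∃ v ∈ S, R v x} : ℝ) ≤ m := by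
  have key : ∀ t : ℕ, ∃ S ⊆ K, S.card ≤ t ∧ ((#{x ∈ T | ¬ ∃ v ∈ S, R v x} : ℝ) ≤ m ∨
      (#{x ∈ T | ¬ ∃ v ∈ S, R v x} : ℝ) ≤ T.card * Real.exp (-(q * t))) := by
    intro t
    induction t with
    | zero =>
      refine ⟨∅, empty_subset _, by simp, Or.inr ?_⟩
      simp
    | succ t ih =>
      obtain ⟨S, hSK, hSt, h⟩ := ih
      by_cases hm : (#{x ∈ T | ¬ ∃ v ∈ S, R v x} : ℝ) ≤ m
      · exact ⟨S, hSK, by omega, Or.inl hm⟩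
      · have h := h.resolve_left hm
        set T' := {x ∈ T | ¬ ∃ v ∈ S, R v x} with hT'
        obtain ⟨v, hv, hvq⟩ := hstep T' (filter_subset _ _) (not_le.1 hm).le
        refine ⟨insert v S, insert_subset hv hSK, (card_insert_le _ _).trans (by omega),
          Or.inr ?_⟩
        have h1 : {x ∈ T | ¬ ∃ w ∈ insert v S, R w x} = {x ∈ T' | ¬ R v x} := by
          ext x
          simp only [hT', mem_filter, exists_mem_insert, not_or]
          tauto
        have h2 : #{x ∈ T' | R v x} + #{x ∈ T' | ¬ R v x} = T'.card :=
          card_filter_add_card_filter_not _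
        have h2' : (#{x ∈ T' | R v x} : ℝ) + #{x ∈ T' | ¬ R v x} = T'.card := by exact_mod_cast h2
        rw [h1]
        calc (#{x ∈ T' | ¬ R v x} : ℝ) ≤ T'.card * (1 - q) := by linarith
          _ ≤ T'.card * Real.exp (-q) := by
              gcongr
              have := Real.add_one_le_exp (-q); linarith
          _ ≤ (T.card * Real.exp (-(q * t))) * Real.exp (-q) := by gcongr
          _ = T.card * Real.exp (-(q * (t + 1 : ℕ))) := by
              rw [mul_assoc, ← Real.exp_add]; push_cast; ring_nf
  obtain ⟨S, hSK, hSt, h⟩ := key ⌈L / q⌉₊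
  refine ⟨S, hSK, ?_, ?_⟩
  · have h1 := Nat.ceil_lt_add_one (show 0 ≤ L / q by positivity)
    have h2 : (S.card : ℝ) ≤ ⌈L / q⌉₊ := by exact_mod_cast hSt
    linarith
  · rcases h with h | h
    · exact h
    · have h1 : L ≤ q * ⌈L / q⌉₊ := by
        have := Nat.le_ceil (L / q)
        rw [div_le_iff₀ hq] at this
        linarith
      have hm : 0 ≤ m := by
        by_contra hneg
        have : m * Real.exp L < 0 := mul_neg_of_neg_of_pos (not_le.1 hneg) (Real.exp_pos _)
        have h0 : (0 : ℝ) ≤ T.card := by positivity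
        linarith
      calc _ ≤ _ := h
        _ ≤ (m * Real.exp L) * Real.exp (-(q * ⌈L / q⌉₊)) := by gcongr
        _ = m * Real.exp (L - q * ⌈L / q⌉₊) := by
            rw [mul_assoc, ← Real.exp_add]; ring_nf
        _ ≤ m * 1 := by
            gcongr
            exact Real.exp_le_one_iff.2 (by linarith)
        _ = m := mul_one m

/-- Greedily removing, as long as possible, an element together with the at least `s` elements it
dominates. -/
theorem exists_dominating_of_bound {s : ℕ} (hs : 1 ≤ s) (T : Finset β) :
    ∃ S ⊆ T, s * S.card ≤ T.card ∧ ∀ x ∈ T, (¬ ∃ v ∈ S, R v x) →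
      #{y ∈ T | (¬ ∃ v ∈ S, R v y) ∧ R x y} < s := by
  induction T using Finset.strongInduction with
  | H T ih =>
    by_cases h : ∃ x ∈ T, s ≤ #{y ∈ T | R x y}
    · obtain ⟨x, hx, hxs⟩ := h
      have hcard : #{y ∈ T | R x y} + #{y ∈ T | ¬ R x y} = T.card :=
        card_filter_add_card_filter_not _
      have hss : {y ∈ T | ¬ R x y} ⊂ T := by
        refine ssubset_of_subset_of_ne (filter_subset _ _) fun heq => ?_
        rw [heq] at hcard
        omega
      obtain ⟨S, hS, hSc, hSd⟩ := ih _ hss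
      refine ⟨insert x S, insert_subset hx (hS.trans (filter_subset _ _)), ?_, ?_⟩
      · have h1 := card_insert_le x S
        have h2 : s * (insert x S).card ≤ s * (S.card + 1) := Nat.mul_le_mul_left s h1
        rw [mul_add, mul_one] at h2
        omega
      · intro z hz hzn
        simp only [exists_mem_insert, not_or] at hzn
        have := hSd z (mem_filter.2 ⟨hz, hzn.1⟩) hzn.2
        convert this using 2
        ext y
        simp only [mem_filter, exists_mem_insert, not_or]
        tauto
    · push Not at h
      refine ⟨∅, empty_subset _, by simp, fun x hx _ => ?_⟩
      simpa using h x hx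

end Greedy

/-! ### Degrees in the Johnson graph -/

section Degree

variable {α : Type*} [DecidableEq α] [Fintype α]

/-- The number of members of `K` at distance one from `X`. -/
def deg (K : Finset (Finset α)) (X : Finset α) : ℕ := #{p ∈ X ×ˢ Xᶜ | swap X p.1 p.2 ∈ K}

theorem deg_le_card_filter {K : Finset (Finset α)} {X : Finset α} (P : Finset α → Prop)
    [DecidablePred P] (h : ∀ e ∈ X, ∀ f ∉ X, swap X e f ∈ K → P (swap X e f)) :
    deg K X ≤ #{Y ∈ K | P Y} := by
  refine card_le_card_of_injOn (fun p => swap X p.1 p.2) ?_ ?_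
  · intro p hp
    simp only [coe_filter, mem_product, mem_compl, Set.mem_ofPred_eq] at hp
    simp only [coe_filter, Set.mem_ofPred_eq]
    exact ⟨hp.2, h _ hp.1.1 _ hp.1.2 hp.2⟩
  · intro p hp p' _ hpp
    simp only [coe_filter, mem_product, mem_compl, Set.mem_ofPred_eq] at hp
    obtain ⟨h1, h2⟩ := swap_inj hp.1.1 hp.1.2 hpp
    exact Prod.ext h1 h2

theorem sum_deg_comm (K T : Finset (Finset α)) : ∑ X ∈ K, deg T X = ∑ X ∈ T, deg K X := by
  simp only [deg]
  rw [← card_sigma, ← card_sigma]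
  have aux : ∀ (K T : Finset (Finset α)) (a : (_ : Finset α) × α × α),
      a ∈ K.sigma (fun X => {p ∈ X ×ˢ Xᶜ | swap X p.1 p.2 ∈ T}) →
      (⟨swap a.1 a.2.1 a.2.2, (a.2.2, a.2.1)⟩ : (_ : Finset α) × α × α) ∈
        T.sigma (fun X => {p ∈ X ×ˢ Xᶜ | swap X p.1 p.2 ∈ K}) := by
    rintro K T ⟨X, e, f⟩ h
    simp only [mem_sigma, mem_filter, mem_product, mem_compl] at h ⊢
    obtain ⟨hX, ⟨he, hf⟩, hs⟩ := h
    refine ⟨hs, ⟨mem_swap, notMem_swap he hf⟩, ?_⟩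
    rwa [swap_swap he hf]
  have inv : ∀ (K T : Finset (Finset α)) (a : (_ : Finset α) × α × α),
      a ∈ K.sigma (fun X => {p ∈ X ×ˢ Xᶜ | swap X p.1 p.2 ∈ T}) →
      (⟨swap (swap a.1 a.2.1 a.2.2) a.2.2 a.2.1, (a.2.1, a.2.2)⟩ : (_ : Finset α) × α × α) = a := by
    rintro K T ⟨X, e, f⟩ h
    simp only [mem_sigma, mem_filter, mem_product, mem_compl] at h
    simp only [swap_swap h.2.1.1 h.2.1.2]
  exact card_bij' (fun a _ => ⟨swap a.1 a.2.1 a.2.2, (a.2.2, a.2.1)⟩)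
    (fun a _ => ⟨swap a.1 a.2.1 a.2.2, (a.2.2, a.2.1)⟩) (aux K T) (aux T K) (inv K T) (inv T K)

/-- The number of members of `K` in the clique formed by the sets `Z - z`. -/
def cliqueCount (K : Finset (Finset α)) (Z : Finset α) : ℕ := #{z ∈ Z | Z.erase z ∈ K}

theorem sum_insert_eq_sum_cliqueCount {r : ℕ} {K : Finset (Finset α)} (hK : K ⊆ powersetCard r univ)
    (g : Finset α → ℕ) :
    ∑ X ∈ K, ∑ f ∈ Xᶜ, g (insert f X) =
      ∑ Z ∈ powersetCard (r + 1) univ, cliqueCount K Z * g Z := by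
  have h1 : ∀ Z : Finset α, cliqueCount K Z * g Z = ∑ _z ∈ {z ∈ Z | Z.erase z ∈ K}, g Z := by
    intro Z; rw [sum_const, smul_eq_mul]; rfl
  simp only [h1]
  rw [sum_sigma', sum_sigma']
  refine sum_bij' (fun a _ => ⟨insert a.2 a.1, a.2⟩) (fun a _ => ⟨a.1.erase a.2, a.2⟩) ?_ ?_ ?_ ?_ ?_
  · rintro ⟨X, f⟩ h
    simp only [mem_sigma, mem_compl] at h
    have hX := (mem_powersetCard.1 (hK h.1)).2
    simp only [mem_sigma, mem_powersetCard, mem_filter]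
    refine ⟨⟨subset_univ _, by rw [card_insert_of_notMem h.2, hX]⟩, mem_insert_self _ _, ?_⟩
    rw [erase_insert h.2]; exact h.1
  · rintro ⟨Z, z⟩ h
    simp only [mem_sigma, mem_filter] at h
    simp only [mem_sigma, mem_compl]
    exact ⟨h.2.2, notMem_erase _ _⟩
  · rintro ⟨X, f⟩ h
    simp only [mem_sigma, mem_compl] at h
    simp [erase_insert h.2]
  · rintro ⟨Z, z⟩ h
    simp only [mem_sigma, mem_filter] at h
    simp [insert_erase h.2.1]
  · rintro ⟨X, f⟩ _
    rfl

theorem deg_add_eq_sum_cliqueCount {r : ℕ} {K : Finset (Finset α)} {X : Finset α} (hX : X ∈ K)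
    (hXr : X.card = r) :
    deg K X + (Fintype.card α - r) = ∑ f ∈ Xᶜ, cliqueCount K (insert f X) := by
  have h1 : deg K X = ∑ f ∈ Xᶜ, #{e ∈ X | swap X e f ∈ K} := by
    simp only [deg, card_filter]
    rw [sum_product_right]
  have h2 : Fintype.card α - r = ∑ f ∈ Xᶜ, 1 := by
    rw [sum_const, smul_eq_mul, mul_one, card_compl, hXr]
  rw [h1, h2, ← sum_add_distrib]
  refine sum_congr rfl fun f hf => ?_
  have hf : f ∉ X := mem_compl.1 hf
  have h3 : {z ∈ insert f X | (insert f X).erase z ∈ K} = insert f {e ∈ X | swap X e f ∈ K} := by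
    rw [filter_insert, erase_insert hf, if_pos hX]
    congr 1
    refine filter_congr fun e he => ?_
    have hne : f ≠ e := fun h => hf (h ▸ he)
    rw [swap, erase_insert_of_ne hne]
  rw [cliqueCount, h3, card_insert_of_notMem (by simp [hf])]

/-- The edges of the Johnson graph are partitioned into the cliques `{Z - z | z ∈ Z}`, so by the
Cauchy-Schwarz inequality a family larger than twice the expected size of a stable set has a vertex
of large degree. -/
theorem exists_large_deg {r : ℕ} {K : Finset (Finset α)} (hK : K ⊆ powersetCard r univ)
    (hr : r < Fintype.card α) (hne : K.Nonempty)
    (hlarge : 2 * (Fintype.card α).choose r ≤ K.card * (r + 1)) :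
    ∃ X ∈ K, K.card * ((Fintype.card α - r) * (r + 1)) ≤
      2 * (Fintype.card α).choose r * deg K X := by
  set n := Fintype.card α with hn
  set N := n.choose r with hN
  set W := powersetCard (r + 1) (univ : Finset α) with hW
  have hWc : W.card * (r + 1) = N * (n - r) := by
    rw [hW, card_powersetCard, card_univ, ← hn]
    exact Nat.choose_succ_right_eq n r
  have hXr : ∀ X ∈ K, X.card = r := fun X hX => (mem_powersetCard.1 (hK hX)).2
  have hsum1 : K.card * (n - r) = ∑ Z ∈ W, cliqueCount K Z := by
    have h := sum_insert_eq_sum_cliqueCount hK (fun _ => 1)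
    simp only [mul_one, sum_const, smul_eq_mul] at h
    rw [hW, ← h, ← smul_eq_mul, ← sum_const]
    exact sum_congr rfl fun X hX => by rw [card_compl, hXr X hX]
  have hsum2 : ∑ X ∈ K, deg K X + K.card * (n - r) = ∑ Z ∈ W, cliqueCount K Z ^ 2 := by
    have h := sum_insert_eq_sum_cliqueCount hK (cliqueCount K)
    simp only [← sq] at h
    rw [hW, ← h, ← smul_eq_mul, ← sum_const, ← sum_add_distrib]
    exact sum_congr rfl fun X hX => deg_add_eq_sum_cliqueCount hX (hXr X hX)
  have hcs : (K.card * (n - r)) ^ 2 ≤ W.card * (∑ X ∈ K, deg K X + K.card * (n - r)) := by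
    rw [hsum1, ← hsum1, hsum2, hsum1]
    exact sq_sum_le_card_mul_sum_sq
  by_contra hcon
  push Not at hcon
  have hlt : ∑ X ∈ K, 2 * N * deg K X < ∑ X ∈ K, K.card * ((n - r) * (r + 1)) :=
    sum_lt_sum_of_nonempty hne hcon
  rw [← mul_sum, sum_const, smul_eq_mul] at hlt
  set D := ∑ X ∈ K, deg K X
  have hpos : 0 < n - r := by omega
  set k := K.card
  set d := n - r
  have h1 : (k * d) ^ 2 * (r + 1) ≤ N * d * (D + k * d) := by
    calc (k * d) ^ 2 * (r + 1) ≤ W.card * (D + k * d) * (r + 1) := Nat.mul_le_mul_right _ hcs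
      _ = W.card * (r + 1) * (D + k * d) := by ring
      _ = _ := by rw [hWc]
  have h2 : d * (k * (k * (d * (r + 1)))) ≤ d * (N * (D + k * d)) := by
    calc _ = (k * d) ^ 2 * (r + 1) := by ring
      _ ≤ _ := h1
      _ = _ := by ring
  have h3 := Nat.le_of_mul_le_mul_left h2 hpos
  have h4 : 2 * N * (k * d) ≤ k * (k * (d * (r + 1))) := by
    calc 2 * N * (k * d) ≤ k * (r + 1) * (k * d) := Nat.mul_le_mul_right _ hlarge
      _ = _ := by ring
  nlinarith

/-- Some member of `K` has many neighbours in `T` if the members of `T` have many neighbours in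
`K`. -/
theorem exists_large_deg_of_forall {r D : ℕ} {K T : Finset (Finset α)}
    (hK : K ⊆ powersetCard r univ) (hne : K.Nonempty) (hD : ∀ X ∈ T, D ≤ 2 * deg K X) :
    ∃ v ∈ K, T.card * D ≤ 2 * (Fintype.card α).choose r * deg T v := by
  have hKc : K.card ≤ (Fintype.card α).choose r := by
    simpa using card_le_card hK
  by_contra hcon
  push Not at hcon
  have h1 : ∑ v ∈ K, 2 * (Fintype.card α).choose r * deg T v < ∑ v ∈ K, T.card * D :=
    sum_lt_sum_of_nonempty hne hcon
  rw [← mul_sum, sum_deg_comm, sum_const, smul_eq_mul] at h1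
  have h2 : T.card * D ≤ 2 * ∑ X ∈ T, deg K X := by
    rw [mul_sum, ← smul_eq_mul, ← sum_const]
    exact sum_le_sum hD
  have h3 : K.card * (T.card * D) ≤ (Fintype.card α).choose r * (2 * ∑ X ∈ T, deg K X) :=
    Nat.mul_le_mul hKc h2
  linarith

end Degree

/-! ### Covers and the encoding of a matroid -/

section Cover

variable {α : Type*} [DecidableEq α]

theorem coveredBy_biUnion {S : Finset (Finset α)} {c : Finset α → Finset (Finset α × ℕ)}
    {Y : Finset α} : CoveredBy (S.biUnion c) Y ↔ ∃ v ∈ S, CoveredBy (c v) Y := by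
  simp only [CoveredBy, mem_biUnion]
  constructor
  · rintro ⟨φ, ⟨v, hv, hφ⟩, h⟩
    exact ⟨v, hv, φ, hφ, h⟩
  · rintro ⟨v, hv, φ, hφ, h⟩
    exact ⟨φ, ⟨v, hv, hφ⟩, h⟩

variable [Fintype α]

/-- No two members of `I` are at distance one; for families of `r`-sets these are the stable sets
of the Johnson graph. -/
def Stable (I : Finset (Finset α)) : Prop := ∀ X ∈ I, ∀ e ∈ X, ∀ f ∉ X, swap X e f ∉ I

/-- The family of non-bases reconstructed from certificates `F` and a stable set `I`. A neighbour
`Y - e + f` of `Y ∈ I` is included when more than half of the sets `Y - e' + f` are covered, or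
more than half of the sets `Y - e + f'`. -/
def decode (r : ℕ) (F : Finset (Finset α × ℕ)) (I : Finset (Finset α)) : Finset (Finset α) :=
  {X ∈ powersetCard r univ | CoveredBy F X ∨ X ∈ I ∨ ∃ Y ∈ I, ∃ e ∈ Y, ∃ f ∈ Yᶜ, X = swap Y e f ∧
    (r < 2 * #{e' ∈ Y | CoveredBy F (swap Y e' f)} ∨
      Fintype.card α - r < 2 * #{f' ∈ Yᶜ | CoveredBy F (swap Y e f')})}

theorem exists_maximal_stable (K : Finset (Finset α)) :
    ∃ I ⊆ K, Stable I ∧ ∀ X ∈ K, X ∉ I → ∃ Y ∈ I, ∃ e ∈ Y, ∃ f ∉ Y, X = swap Y e f := by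
  classical
  obtain ⟨I, hI, hmax⟩ := exists_max_image {I ∈ K.powerset | Stable I} card
    ⟨∅, mem_filter.2 ⟨empty_mem_powerset _, fun X hX => absurd hX (notMem_empty _)⟩⟩
  rw [mem_filter, mem_powerset] at hI
  refine ⟨I, hI.1, hI.2, fun X hX hXI => ?_⟩
  by_contra hcon
  push Not at hcon
  have hst : Stable (insert X I) := by
    intro Y hY e he f hf h
    rcases mem_insert.1 hY with rfl | hY <;> rcases mem_insert.1 h with h | h
    · exact hf (h ▸ mem_swap)
    · exact hcon _ h f mem_swap e (notMem_swap he hf) (swap_swap he hf).symm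
    · exact hcon Y hY e he f hf h.symm
    · exact hI.2 Y hY e he f hf h
  have := hmax (insert X I)
    (mem_filter.2 ⟨mem_powerset.2 (insert_subset hX hI.1), hst⟩)
  rw [card_insert_of_notMem hXI] at this
  omega

/-- If the degree of `Y` in `K` is small and most of its neighbours in `K` are covered by `F`, then
the covered neighbours determine which elements `f` lie in the span of `Y`, and which elements `e`
avoid its circuit. -/
theorem swap_mem_iff_of_covered {r s : ℕ} {K : Finset (Finset α)} {F : Finset (Finset α × ℕ)}
    {Y A B : Finset α} {c : Finset (Finset α × ℕ)} (hY : Y.card = r)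
    (hc : LocalCover r K Y A B c) (hF : ∀ Z : Finset α, Z.card = r → CoveredBy F Z → Z ∈ K)
    (hs1 : 2 * s ≤ r) (hs2 : 2 * s ≤ Fintype.card α - r)
    (hdeg : 2 * deg K Y < r * (Fintype.card α - r))
    (hunc : deg {Z ∈ K | ¬ CoveredBy F Z} Y < s) {e f : α} (he : e ∈ Y) (hf : f ∉ Y) :
    swap Y e f ∈ K ↔ (r < 2 * #{e' ∈ Y | CoveredBy F (swap Y e' f)} ∨
      Fintype.card α - r < 2 * #{f' ∈ Yᶜ | CoveredBy F (swap Y e f')}) := by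
  have hYc : Yᶜ.card = Fintype.card α - r := by rw [card_compl, hY]
  set d := Fintype.card α - r with hd
  have hA : 2 * A.card < r := by
    have h1 : (A ×ˢ Yᶜ).card ≤ deg K Y := by
      refine card_le_card fun p hp => ?_
      simp only [mem_product, mem_compl] at hp
      simp only [mem_filter, mem_product, mem_compl]
      have := hc.subset_left hp.1
      exact ⟨⟨this, hp.2⟩, (hc.swap_mem_iff _ this _ hp.2).2 (Or.inl hp.1)⟩
    rw [card_product, hYc] at h1
    by_contra hcon
    have : r * d ≤ 2 * A.card * d := Nat.mul_le_mul_right d (not_lt.1 hcon)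
    rw [mul_assoc] at this
    omega
  have hB : 2 * B.card < d := by
    have h1 : (Y ×ˢ B).card ≤ deg K Y := by
      refine card_le_card fun p hp => ?_
      simp only [mem_product] at hp
      simp only [mem_filter, mem_product, mem_compl]
      have := disjoint_left.1 hc.disjoint_right hp.2
      exact ⟨⟨hp.1, this⟩, (hc.swap_mem_iff _ hp.1 _ this).2 (Or.inr hp.2)⟩
    rw [card_product, hY] at h1
    by_contra hcon
    have : r * d ≤ r * (2 * B.card) := Nat.mul_le_mul_left r (not_lt.1 hcon)
    rw [mul_left_comm] at this
    omega
  have hcardswap : ∀ e ∈ Y, ∀ f ∉ Y, (swap Y e f).card = r := fun e he f hf => by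
    rw [card_swap he hf, hY]
  have hBiff : ∀ f ∉ Y, (f ∈ B ↔ r < 2 * #{e' ∈ Y | CoveredBy F (swap Y e' f)}) := by
    intro f hf
    constructor
    · intro hfB
      have h1 : #{e' ∈ Y | CoveredBy F (swap Y e' f)} + #{e' ∈ Y | ¬ CoveredBy F (swap Y e' f)} = r :=
        (card_filter_add_card_filter_not _).trans hY
      have h2 : #{e' ∈ Y | ¬ CoveredBy F (swap Y e' f)} ≤ deg {Z ∈ K | ¬ CoveredBy F Z} Y := by
        refine card_le_card_of_injOn (fun e' => (e', f)) ?_ ?_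
        · intro e' he'
          simp only [coe_filter, Set.mem_ofPred_eq] at he'
          simp only [mem_coe, mem_filter, mem_product, mem_compl]
          exact ⟨⟨he'.1, hf⟩, (hc.swap_mem_iff _ he'.1 _ hf).2 (Or.inr hfB), he'.2⟩
        · intro a _ b _ hab
          exact (Prod.ext_iff.1 hab).1
      omega
    · intro h
      by_contra hfB
      have h2 : #{e' ∈ Y | CoveredBy F (swap Y e' f)} ≤ A.card := by
        refine card_le_card fun e' he' => ?_
        rw [mem_filter] at he'
        exact ((hc.swap_mem_iff _ he'.1 _ hf).1 (hF _ (hcardswap _ he'.1 _ hf) he'.2)).resolve_right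
          hfB
      omega
  have hAiff : ∀ e ∈ Y, (e ∈ A ↔ d < 2 * #{f' ∈ Yᶜ | CoveredBy F (swap Y e f')}) := by
    intro e he
    constructor
    · intro heA
      have h1 : #{f' ∈ Yᶜ | CoveredBy F (swap Y e f')} + #{f' ∈ Yᶜ | ¬ CoveredBy F (swap Y e f')} =
          d := (card_filter_add_card_filter_not _).trans hYc
      have h2 : #{f' ∈ Yᶜ | ¬ CoveredBy F (swap Y e f')} ≤ deg {Z ∈ K | ¬ CoveredBy F Z} Y := by
        refine card_le_card_of_injOn (fun f' => (e, f')) ?_ ?_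
        · intro f' hf'
          simp only [coe_filter, Set.mem_ofPred_eq, mem_compl] at hf'
          simp only [mem_coe, mem_filter, mem_product, mem_compl]
          exact ⟨⟨he, hf'.1⟩, (hc.swap_mem_iff _ he _ hf'.1).2 (Or.inl heA), hf'.2⟩
        · intro a _ b _ hab
          exact (Prod.ext_iff.1 hab).2
      omega
    · intro h
      by_contra heA
      have h2 : #{f' ∈ Yᶜ | CoveredBy F (swap Y e f')} ≤ B.card := by
        refine card_le_card fun f' hf' => ?_
        rw [mem_filter, mem_compl] at hf'
        exact ((hc.swap_mem_iff _ he _ hf'.1).1 (hF _ (hcardswap _ he _ hf'.1) hf'.2)).resolve_left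
          heA
      omega
  rw [hc.swap_mem_iff _ he _ hf, hBiff f hf, hAiff e he, or_comm]

/-- The stable set is a maximal one among the uncovered members of `K`, so that every other
uncovered member is a neighbour of it, where `swap_mem_iff_of_covered` decides membership in `K`.
-/
theorem exists_eq_decode {r s : ℕ} {K : Finset (Finset α)} {F : Finset (Finset α × ℕ)}
    (hK : K ⊆ powersetCard r univ)
    (hc : ∀ X ∈ K, ∃ A B c, LocalCover r K X A B c)
    (hF : ∀ Z : Finset α, Z.card = r → CoveredBy F Z → Z ∈ K)
    (hs1 : 2 * s ≤ r) (hs2 : 2 * s ≤ Fintype.card α - r)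
    (hdeg : ∀ X ∈ K, ¬ CoveredBy F X → 2 * deg K X < r * (Fintype.card α - r))
    (hunc : ∀ X ∈ K, ¬ CoveredBy F X → deg {Z ∈ K | ¬ CoveredBy F Z} X < s) :
    ∃ I ⊆ powersetCard r univ, Stable I ∧ K = decode r F I := by
  obtain ⟨I, hIK, hI, hmax⟩ := exists_maximal_stable {Z ∈ K | ¬ CoveredBy F Z}
  have hIK' : I ⊆ K := hIK.trans (filter_subset _ _)
  have hiff : ∀ Y ∈ I, ∀ e ∈ Y, ∀ f ∉ Y, (swap Y e f ∈ K ↔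
      (r < 2 * #{e' ∈ Y | CoveredBy F (swap Y e' f)} ∨
      Fintype.card α - r < 2 * #{f' ∈ Yᶜ | CoveredBy F (swap Y e f')})) := by
    intro Y hY e he f hf
    obtain ⟨hYK, hYF⟩ := mem_filter.1 (hIK hY)
    obtain ⟨A, B, c, h⟩ := hc Y hYK
    exact swap_mem_iff_of_covered (mem_powersetCard.1 (hK hYK)).2 h hF hs1 hs2
      (hdeg Y hYK hYF) (hunc Y hYK hYF) he hf
  refine ⟨I, hIK'.trans hK, hI, ?_⟩
  ext X
  simp only [decode, mem_filter, mem_compl]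
  constructor
  · intro hX
    refine ⟨hK hX, ?_⟩
    by_cases h1 : CoveredBy F X
    · exact Or.inl h1
    · by_cases h2 : X ∈ I
      · exact Or.inr (Or.inl h2)
      · obtain ⟨Y, hY, e, he, f, hf, rfl⟩ := hmax X (mem_filter.2 ⟨hX, h1⟩) h2
        exact Or.inr (Or.inr ⟨Y, hY, e, he, f, hf, rfl, (hiff Y hY e he f hf).1 hX⟩)
  · rintro ⟨hXr, h | h | ⟨Y, hY, e, he, f, hf, rfl, h⟩⟩
    · exact hF X (mem_powersetCard.1 hXr).2 h
    · exact hIK' h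
    · exact (hiff Y hY e he f hf).2 h

/-- There are few certificates covering all members of `K` of large degree in `K`, such that in
addition the uncovered members of `K` span a subgraph of the Johnson graph of degree less than
`s`. -/
theorem exists_cover {n r s : ℕ} (hn : Fintype.card α = n) {K : Finset (Finset α)}
    (hK : K ⊆ powersetCard r univ) (hr : 0 < r) (hrn : r < n) (hs : 1 ≤ s)
    (c : Finset α → Finset (Finset α × ℕ))
    (hc : ∀ X ∈ K, ∃ A B, LocalCover r K X A B (c X)) :
    ∃ S ⊆ K, (S.card : ℝ) ≤
        2 * Real.log n / ((r * (n - r : ℕ) : ℕ) / (2 * n.choose r)) + n.choose r / n ^ 2 +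
        Real.log n / (((n - r) * (r + 1) : ℕ) / (2 * n.choose r)) +
        2 * n.choose r / (r + 1) / s + 2 ∧
      (∀ X ∈ K, ¬ CoveredBy (S.biUnion c) X → 2 * deg K X < r * (n - r)) ∧
      ∀ X ∈ K, ¬ CoveredBy (S.biUnion c) X → deg {Z ∈ K | ¬ CoveredBy (S.biUnion c) Z} X < s := by
  subst hn
  set n := Fintype.card α with hn
  set N := n.choose r with hN
  have hNpos : 0 < N := Nat.choose_pos hrn.le
  have hn1 : 1 ≤ n := by omega
  have hlog : 0 ≤ Real.log n := Real.log_natCast_nonneg n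
  have hnR : (0 : ℝ) < n := by exact_mod_cast hn1
  have hKN : K.card ≤ N := by simpa using card_le_card hK
  have hcov : ∀ X ∈ K, ∀ T ⊆ K, deg T X ≤ #{Y ∈ T | CoveredBy (c X) Y} := by
    intro X hX T hT
    obtain ⟨A, B, h⟩ := hc X hX
    exact deg_le_card_filter _ fun e he f hf hs => h.covered e he f hf (hT hs)
  rcases K.eq_empty_or_nonempty with rfl | hKne
  · refine ⟨∅, subset_rfl, ?_, by simp, by simp⟩
    simp only [card_empty, Nat.cast_zero]
    positivity
  set R : Finset α → Finset α → Prop := fun v x => CoveredBy (c v) x with hR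
  have hdpos : 0 < n - r := by omega
  -- a greedy choice covers all but a fraction `1 / n ^ 2` of the vertices of large degree
  set T₀ : Finset (Finset α) := {X ∈ K | r * (n - r) ≤ 2 * deg K X} with hT₀
  have hT₀K : T₀ ⊆ K := filter_subset _ _
  obtain ⟨S₀, hS₀K, hS₀c, hS₀m⟩ := exists_dominating_of_proportion R K T₀
    (q := (r * (n - r : ℕ) : ℕ) / (2 * N)) (m := N / n ^ 2) (L := 2 * Real.log n)
    (by positivity) (by positivity)
    (by
      rw [two_mul, Real.exp_add, Real.exp_log hnR]
      have h1 : (T₀.card : ℝ) ≤ N := by exact_mod_cast (card_le_card hT₀K).trans hKN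
      calc (T₀.card : ℝ) ≤ N := h1
        _ = N / n ^ 2 * (n * n) := by field_simp)
    (by
      intro T' hT' _
      obtain ⟨v, hv, h⟩ := exists_large_deg_of_forall (D := r * (n - r)) hK hKne
        (T := T') (fun X hX => (mem_filter.1 (hT' hX)).2)
      refine ⟨v, hv, ?_⟩
      have h2 := hcov v hv T' (hT'.trans hT₀K)
      have h3 : T'.card * (r * (n - r)) ≤ 2 * N * #{Y ∈ T' | CoveredBy (c v) Y} :=
        h.trans (Nat.mul_le_mul_left _ h2)
      have h4 : (T'.card : ℝ) * (r * (n - r : ℕ) : ℕ) ≤ 2 * N * #{Y ∈ T' | CoveredBy (c v) Y} := by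
        exact_mod_cast h3
      rw [div_mul_eq_mul_div, div_le_iff₀ (by positivity)]
      linarith)
  -- by `exists_large_deg`, another greedy choice leaves at most `2 * N / (r + 1)` vertices uncovered
  obtain ⟨S₁, hS₁K, hS₁c, hS₁m⟩ := exists_dominating_of_proportion R K K
    (q := ((n - r) * (r + 1) : ℕ) / (2 * N)) (m := 2 * N / (r + 1)) (L := Real.log n)
    (by positivity) hlog
    (by
      rw [Real.exp_log hnR]
      have h1 : (K.card : ℝ) ≤ N := by exact_mod_cast hKN
      have h2 : (r : ℝ) + 1 ≤ n := by exact_mod_cast hrn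
      refine h1.trans ?_
      rw [div_mul_eq_mul_div, le_div_iff₀ (by positivity), mul_right_comm, mul_comm, mul_comm _ (N : ℝ)]
      nlinarith [show (0 : ℝ) < N by exact_mod_cast hNpos])
    (by
      intro T' hT' hm
      rw [div_le_iff₀ (by positivity)] at hm
      have hm' : 2 * N ≤ T'.card * (r + 1) := by exact_mod_cast hm
      have hne : T'.Nonempty := by
        rw [← card_pos]
        by_contra h0
        have : T'.card = 0 := by omega
        rw [this] at hm'
        omega
      obtain ⟨v, hv, h⟩ := exists_large_deg (hT'.trans hK) hrn hne hm'
      refine ⟨v, hT' hv, ?_⟩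
      have h2 := hcov v (hT' hv) T' hT'
      have h3 := h.trans (Nat.mul_le_mul_left _ h2)
      have h4 : (T'.card : ℝ) * ((n - r) * (r + 1) : ℕ) ≤
          2 * N * #{Y ∈ T' | CoveredBy (c v) Y} := by exact_mod_cast h3
      rw [div_mul_eq_mul_div, div_le_iff₀ (by positivity)]
      linarith)
  -- the vertices of `U₀` are chosen one by one, and a last greedy choice reduces the degrees
  set U₀ : Finset (Finset α) := {x ∈ T₀ | ¬ ∃ v ∈ S₀, R v x} with hU₀
  set T : Finset (Finset α) := {x ∈ K | ¬ ∃ v ∈ S₀ ∪ U₀ ∪ S₁, R v x} with hT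
  obtain ⟨S₂, hS₂T, hS₂c, hS₂d⟩ := exists_dominating_of_bound R hs T
  have hTK : T ⊆ K := filter_subset _ _
  have hU₀K : U₀ ⊆ K := (filter_subset _ _).trans hT₀K
  have hTm : (T.card : ℝ) ≤ 2 * N / (r + 1) := by
    refine le_trans ?_ hS₁m
    norm_cast
    refine card_le_card fun x hx => ?_
    simp only [hT, mem_filter, mem_union] at hx ⊢
    exact ⟨hx.1, fun ⟨v, hv, h⟩ => hx.2 ⟨v, Or.inr hv, h⟩⟩
  have hunion : ∀ x, CoveredBy ((S₀ ∪ U₀ ∪ S₁ ∪ S₂).biUnion c) x ↔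
      (∃ v ∈ S₀ ∪ U₀ ∪ S₁, R v x) ∨ ∃ v ∈ S₂, R v x := by
    intro x
    rw [coveredBy_biUnion]
    constructor
    · rintro ⟨v, hv, h⟩
      rcases mem_union.1 hv with hv | hv
      · exact Or.inl ⟨v, hv, h⟩
      · exact Or.inr ⟨v, hv, h⟩
    · rintro (⟨v, hv, h⟩ | ⟨v, hv, h⟩)
      · exact ⟨v, mem_union_left _ hv, h⟩
      · exact ⟨v, mem_union_right _ hv, h⟩
  refine ⟨S₀ ∪ U₀ ∪ S₁ ∪ S₂, union_subset (union_subset (union_subset hS₀K hU₀K) hS₁K)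
    (hS₂T.trans hTK), ?_, ?_, ?_⟩
  · have h1 : (S₀ ∪ U₀ ∪ S₁ ∪ S₂).card ≤ S₀.card + U₀.card + S₁.card + S₂.card :=
      (card_union_le _ _).trans (Nat.add_le_add_right ((card_union_le _ _).trans
        (Nat.add_le_add_right (card_union_le _ _) _)) _)
    have h2 : ((S₀ ∪ U₀ ∪ S₁ ∪ S₂).card : ℝ) ≤ S₀.card + U₀.card + S₁.card + S₂.card := by
      exact_mod_cast h1
    have h3 : (S₂.card : ℝ) ≤ 2 * N / (r + 1) / s := by
      have hs' : (0 : ℝ) < s := by exact_mod_cast hs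
      rw [le_div_iff₀ hs']
      refine le_trans ?_ hTm
      rw [mul_comm]
      exact_mod_cast hS₂c
    linarith
  · intro X hX hXc
    by_contra hcon
    have hXT : X ∈ T₀ := mem_filter.2 ⟨hX, not_lt.1 hcon⟩
    rw [hunion, not_or] at hXc
    have hXU : X ∈ U₀ := mem_filter.2 ⟨hXT, fun ⟨v, hv, h⟩ =>
      hXc.1 ⟨v, mem_union_left _ (mem_union_left _ hv), h⟩⟩
    obtain ⟨A, B, h⟩ := hc X hX
    exact hXc.1 ⟨X, mem_union_left _ (mem_union_right _ hXU), h.self⟩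
  · intro X hX hXc
    rw [hunion, not_or] at hXc
    have h1 := hS₂d X (mem_filter.2 ⟨hX, hXc.1⟩) hXc.2
    refine lt_of_le_of_lt (hcov X hX _ (filter_subset _ _)) (lt_of_le_of_lt (card_le_card ?_) h1)
    intro y hy
    simp only [mem_filter, hunion, not_or] at hy
    simp only [hT, mem_filter]
    exact ⟨⟨hy.1.1, hy.1.2.1⟩, hy.1.2.2, hy.2⟩

end Cover

/-! ### Sparse paving matroids and stable sets -/

section SparsePaving

variable {α : Type*}

theorem eRank_eq_of_isBase {M : Matroid α} {r : ℕ} {X : Finset α} (hX : M.IsBase X)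
    (hr : X.card = r) : M.eRank = r := by
  rw [← hX.encard_eq_eRank, Set.encard_coe_eq_coe_finsetCard, hr]

variable [DecidableEq α]

theorem Stable.swap_notMem {I : Finset (Finset α)} (hI : Stable I) {X : Finset α} (hX : X ∈ I)
    {e f : α} (he : e ∈ X) (hf : f ∉ X) : swap X e f ∉ I := hI X hX e he f hf

variable [Fintype α]

/-- A set with fewer than `r` elements has an extension to an `r`-set outside any given stable
set. -/
theorem Stable.exists_superset {I : Finset (Finset α)} (hI : Stable I) {r : ℕ}
    (hr : r < Fintype.card α) {C : Finset α} (hC : C.card < r) :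
    ∃ X, C ⊆ X ∧ X.card = r ∧ X ∉ I := by
  obtain ⟨X, hCX, -, hX⟩ := exists_subsuperset_card_eq (subset_univ C) hC.le
    (by rw [card_univ]; exact hr.le)
  by_cases hXI : X ∈ I
  · obtain ⟨e, he, heC⟩ : ∃ e ∈ X, e ∉ C := by
      by_contra hcon
      push Not at hcon
      have := card_le_card (show X ⊆ C from hcon)
      omega
    obtain ⟨f, hf⟩ : ∃ f, f ∉ X := by
      by_contra hcon
      push Not at hcon
      have := card_le_card (show univ ⊆ X from fun x _ => hcon x)
      rw [card_univ] at this
      omega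
    refine ⟨swap X e f, fun x hx => mem_insert_of_mem (mem_erase.2 ⟨fun h => heC (h ▸ hx), hCX hx⟩),
      by rw [card_swap he hf, hX], hI.swap_notMem hXI he hf⟩
  · exact ⟨X, hCX, hX, hXI⟩

theorem Stable.isPaving {I : Finset (Finset α)} (hI : Stable I) {r : ℕ}
    (hr : r < Fintype.card α) {M : Matroid α}
    (hM : ∀ X : Finset α, M.IsBase X ↔ X.card = r ∧ X ∉ I) : M.IsPaving := by
  intro C hC
  classical
  obtain ⟨B, hB⟩ := M.exists_isBase
  lift B to Finset α using Set.toFinite B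
  lift C to Finset α using Set.toFinite C
  rw [eRank_eq_of_isBase hB ((hM B).1 hB).1, Set.encard_coe_eq_coe_finsetCard]
  by_contra hlt
  have hlt' : C.card < r := by exact_mod_cast not_le.1 hlt
  obtain ⟨X, hCX, hX⟩ := hI.exists_superset hr hlt'
  exact hC.dep.not_indep (((hM X).2 hX).indep.subset (by exact_mod_cast hCX))

theorem compl_swap {X : Finset α} {e f : α} (he : e ∈ X) (hf : f ∉ X) :
    (swap X e f)ᶜ = swap Xᶜ f e := by
  ext x
  have : e ≠ f := fun h => hf (h ▸ he)
  simp only [swap, mem_compl, mem_insert, mem_erase]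
  by_cases h1 : x = e
  · subst h1; simp [this]
  · simp [h1]

theorem Stable.image_compl {I : Finset (Finset α)} (hI : Stable I) : Stable (I.image compl) := by
  intro X hX e he f hf h
  rw [mem_image] at hX h
  obtain ⟨Y, hY, rfl⟩ := hX
  obtain ⟨Z, hZ, hZY⟩ := h
  rw [mem_compl] at he
  rw [mem_compl, not_not] at hf
  rw [← compl_swap hf he, compl_inj_iff] at hZY
  exact hI.swap_notMem hY hf he (hZY ▸ hZ)

/-- The `r`-sets outside a stable set of the Johnson graph are the bases of a sparse paving
matroid. -/
theorem Stable.exists_sparsePaving {I : Finset (Finset α)} (hI : Stable I) {r : ℕ} (hr0 : 0 < r)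
    (hr : r < Fintype.card α) :
    ∃ M : Matroid α, M.E = Set.univ ∧ M.IsSparsePaving ∧
      ∀ X : Finset α, M.IsBase X ↔ X.card = r ∧ X ∉ I := by
  have hexch : Matroid.ExchangeProperty
      (fun B : Set α => ∃ X : Finset α, (X : Set α) = B ∧ X.card = r ∧ X ∉ I) := by
    rintro _ _ ⟨X, rfl, hXr, hXI⟩ ⟨Y, rfl, hYr, hYI⟩ e ⟨heX, heY⟩
    rw [mem_coe] at heX heY
    have hset : ∀ f, (insert f ((X : Set α) \ {e})) = ((swap X e f : Finset α) : Set α) := by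
      intro f; simp [swap]
    by_contra hcon
    push Not at hcon
    have hbad : ∀ f ∈ Y, f ∉ X → swap X e f ∈ I := by
      intro f hf hfX
      by_contra h
      exact h (hcon f ⟨hf, hfX⟩ (swap X e f) (hset f).symm ((card_swap heX hfX).trans hXr))
    obtain ⟨f, hfY, hfX⟩ : ∃ f ∈ Y, f ∉ X := by
      by_contra h
      push Not at h
      have := eq_of_subset_of_card_le (show Y ⊆ X from h) (by omega)
      exact heY (this ▸ heX)
    by_cases hex : ∃ g ∈ Y, g ∉ X ∧ g ≠ f
    · obtain ⟨g, hgY, hgX, hgf⟩ := hex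
      -- the two candidates for the exchange are adjacent, so not both are in `I`
      have h1 := hbad f hfY hfX
      have hg : g ∉ swap X e f := by simp [swap, hgf, hgX]
      have h2 := hI.swap_notMem h1 mem_swap hg
      have h3 : swap (swap X e f) f g = swap X e g := by
        rw [swap, swap, erase_insert (fun h => hfX (mem_of_mem_erase h))]; rfl
      exact h2 (h3 ▸ hbad g hgY hgX)
    · push Not at hex
      have hsub : Y ⊆ swap X e f := by
        intro y hy
        by_cases hyX : y ∈ X
        · exact mem_insert_of_mem (mem_erase.2 ⟨fun h => heY (h ▸ hy), hyX⟩)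
        · rw [hex y hy hyX]; exact mem_swap
      have heq := eq_of_subset_of_card_le hsub (by rw [card_swap heX hfX]; omega)
      exact hYI (heq ▸ hbad f hfY hfX)
  have hne : ∃ B : Set α, ∃ X : Finset α, (X : Set α) = B ∧ X.card = r ∧ X ∉ I := by
    obtain ⟨X, -, hX⟩ := hI.exists_superset hr (C := ∅) (by simpa using hr0)
    exact ⟨X, X, rfl, hX⟩
  let M := Matroid.ofIsBaseOfFinite (E := Set.univ) (Set.toFinite _) _ hne hexch
    (fun B _ => Set.subset_univ B)
  have hM : ∀ X : Finset α, M.IsBase X ↔ X.card = r ∧ X ∉ I := by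
    intro X
    simp only [M, Matroid.ofIsBaseOfFinite_isBase, coe_inj, exists_eq_left]
  have hE : M.E = Set.univ := rfl
  have hM' : ∀ X : Finset α, M✶.IsBase X ↔ X.card = Fintype.card α - r ∧ X ∉ I.image compl := by
    intro X
    rw [Matroid.dual_isBase_iff (by rw [hE]; exact Set.subset_univ _), hE,
      ← Set.compl_eq_univ_sdiff, ← coe_compl, hM, card_compl]
    have h1 : X ∈ I.image compl ↔ Xᶜ ∈ I := by
      rw [mem_image]
      exact ⟨fun ⟨Y, hY, h⟩ => by rw [← h, compl_compl]; exact hY,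
        fun h => ⟨Xᶜ, h, compl_compl X⟩⟩
    rw [h1]
    have := card_le_univ X
    constructor <;> rintro ⟨h, h'⟩ <;> exact ⟨by omega, h'⟩
  exact ⟨M, hE, ⟨hI.isPaving hr hM, hI.image_compl.isPaving (by omega) hM'⟩, hM⟩

end SparsePaving

open Classical in
/-- The stable sets of the Johnson graph of `r`-subsets of an `n`-set. -/
noncomputable def stableSets (n r : ℕ) : Finset (Finset (Finset (Fin n))) :=
  {I ∈ (powersetCard r univ).powerset | Stable I}

theorem mem_stableSets {n r : ℕ} {I : Finset (Finset (Fin n))} :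
    I ∈ stableSets n r ↔ I ⊆ powersetCard r univ ∧ Stable I := by
  simp only [stableSets, mem_filter, mem_powerset]

theorem card_stableSets_le {n r : ℕ} (hr0 : 0 < r) (hr : r < n) :
    (stableSets n r).card ≤ numSparsePaving n := by
  have := matroid_finite n
  rw [numSparsePaving, ← Set.ncard_coe_finset]
  refine le_trans (Set.ncard_le_ncard ?_ (Set.toFinite _))
    (Set.ncard_image_le (f := fun M => nonbases M r) (Set.toFinite _))
  intro I hI
  obtain ⟨hIr, hI⟩ := mem_stableSets.1 hI
  obtain ⟨M, hE, hs, hM⟩ := hI.exists_sparsePaving hr0 (by simpa using hr)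
  refine ⟨M, ⟨hE, hs⟩, ?_⟩
  ext X
  simp only [mem_nonbases, hM]
  constructor
  · rintro ⟨h1, h2⟩
    by_contra h3
    exact h2 ⟨h1, h3⟩
  · intro h
    exact ⟨(mem_powersetCard.1 (hIr h)).2, fun h' => h'.2 h⟩

/-- The sets whose elements have a prescribed sum modulo `n` form a stable set, and one of these
sets contains at least the average number of `r`-sets. -/
theorem exists_large_stable {n : ℕ} (hn : 0 < n) (r : ℕ) :
    ∃ I ∈ stableSets n r, (n.choose r : ℝ) / n ≤ I.card := by
  obtain ⟨y, -, hy⟩ := exists_le_card_fiber_of_nsmul_le_card_of_maps_to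
    (s := powersetCard r (univ : Finset (Fin n))) (t := range n)
    (f := fun X => (∑ x ∈ X, (x : ℕ)) % n) (b := (n.choose r : ℝ) / n)
    (fun X _ => mem_range.2 (Nat.mod_lt _ hn)) ⟨0, mem_range.2 hn⟩ (by
      rw [card_range, card_powersetCard, card_univ, Fintype.card_fin, nsmul_eq_mul]
      have : (n : ℝ) ≠ 0 := by positivity
      exact le_of_eq (by field_simp))
  refine ⟨_, mem_stableSets.2 ⟨filter_subset _ _, ?_⟩, hy⟩
  intro X hX e he f hf h
  rw [mem_filter] at hX h
  have hfe : f ∉ X.erase e := fun h => hf (mem_of_mem_erase h)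
  have h1 : ∑ x ∈ swap X e f, (x : ℕ) + e = ∑ x ∈ X, (x : ℕ) + f := by
    rw [swap, sum_insert hfe, ← add_sum_erase X _ he]
    ring
  have h2 : (∑ x ∈ swap X e f, (x : ℕ)) ≡ ∑ x ∈ X, (x : ℕ) [MOD n] := h.2.trans hX.2.symm
  have h3 : (e : ℕ) ≡ f [MOD n] := by
    have h4 : ∑ x ∈ swap X e f, (x : ℕ) + e ≡ ∑ x ∈ X, (x : ℕ) + f [MOD n] := by
      rw [h1]
    exact Nat.ModEq.add_left_cancel h2 h4
  exact hf (Fin.ext (Nat.ModEq.eq_of_lt_of_lt h3 e.2 f.2) ▸ he)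

/-- All subsets of a large stable set are stable. -/
theorem le_log_numSparsePaving {n r : ℕ} (hr0 : 0 < r) (hr : r < n) :
    (n.choose r : ℝ) / n * Real.log 2 ≤ Real.log (numSparsePaving n) := by
  obtain ⟨I, hI, hIc⟩ := exists_large_stable (hr0.trans hr) r
  obtain ⟨hIr, hI⟩ := mem_stableSets.1 hI
  have h1 : I.powerset ⊆ stableSets n r := by
    intro J hJ
    rw [mem_powerset] at hJ
    exact mem_stableSets.2 ⟨hJ.trans hIr, fun X hX e he f hf h => hI X (hJ hX) e he f hf (hJ h)⟩
  have h2 : 2 ^ I.card ≤ numSparsePaving n := by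
    rw [← card_powerset]
    exact (card_le_card h1).trans (card_stableSets_le hr0 hr)
  have h3 : (2 : ℝ) ^ I.card ≤ numSparsePaving n := by exact_mod_cast h2
  calc (n.choose r : ℝ) / n * Real.log 2 ≤ I.card * Real.log 2 := by
        gcongr
    _ = Real.log (2 ^ I.card) := (Real.log_pow _ _).symm
    _ ≤ _ := Real.log_le_log (by positivity) h3

/-! ### Counting matroids of a given rank -/

/-- The matroids of rank `r` on an `n`-element ground set. -/
def matroidsOfRank (n r : ℕ) : Set (Matroid (Fin n)) := {M ∈ matroidsOn n | M.eRank = r}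

theorem nonbases_injOn (n r : ℕ) :
    Set.InjOn (fun M : Matroid (Fin n) => nonbases M r) (matroidsOfRank n r) := by
  rintro M ⟨hME, hMr⟩ N ⟨hNE, hNr⟩ h
  have hME : M.E = Set.univ := hME
  have hNE : N.E = Set.univ := hNE
  refine Matroid.ext_isBase (hME.trans hNE.symm) fun B _ => ?_
  lift B to Finset (Fin n) using Set.toFinite B
  have h1 : B ∈ nonbases M r ↔ B ∈ nonbases N r := by
    simp only at h
    rw [h]
  rw [mem_nonbases, mem_nonbases] at h1
  constructor
  · intro hb
    have hc := ((isBase_iff_indep_card hMr).1 hb).2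
    by_contra hb'
    exact (h1.2 ⟨hc, hb'⟩).2 hb
  · intro hb
    have hc := ((isBase_iff_indep_card hNr).1 hb).2
    by_contra hb'
    exact (h1.1 ⟨hc, hb'⟩).2 hb

theorem ncard_matroidsOfRank_le_card {n r : ℕ} (T : Finset (Finset (Finset (Fin n))))
    (hT : ∀ M ∈ matroidsOfRank n r, nonbases M r ∈ T) : (matroidsOfRank n r).ncard ≤ T.card := by
  rw [← Set.ncard_coe_finset]
  exact Set.ncard_le_ncard_of_injOn _ hT (nonbases_injOn n r) (Set.toFinite _)

theorem ncard_matroidsOfRank_le_two_pow (n r : ℕ) :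
    (matroidsOfRank n r).ncard ≤ 2 ^ n.choose r := by
  refine (ncard_matroidsOfRank_le_card (powersetCard r univ).powerset fun M _ =>
    mem_powerset.2 (nonbases_subset M r)).trans ?_
  simp

theorem numLooplessColoopless_le (n : ℕ) :
    numLooplessColoopless n ≤ ∑ r ∈ range (n + 1), (matroidsOfRank n r).ncard := by
  have := matroid_finite n
  refine le_trans (Set.ncard_le_ncard (t := ⋃ r ∈ range (n + 1), matroidsOfRank n r) ?_
    (Set.toFinite _)) (Finset.set_ncard_biUnion_le _ _)
  rintro M ⟨hME, -⟩
  obtain ⟨B, hB⟩ := M.exists_isBase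
  lift B to Finset (Fin n) using Set.toFinite B
  simp only [Set.mem_iUnion, mem_range]
  refine ⟨B.card, ?_, hME, eRank_eq_of_isBase hB rfl⟩
  have := card_le_univ B
  rw [Fintype.card_fin] at this
  omega

/-- The families of at most `κ` certificates. -/
noncomputable def certFamilies (n : ℕ) (κ : ℝ) : Finset (Finset (Finset (Fin n) × ℕ)) :=
  {F ∈ (univ ×ˢ range (n + 1)).powerset | (F.card : ℝ) ≤ κ}

/-- A bound for the number of small families: each of them has weight at least `exp (-a * κ)` when
a family `F` is given the weight `exp (-a * F.card)`, and the weights of all families add up to a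
power of `1 + exp (-a)`. -/
theorem card_certFamilies_le (n : ℕ) {a κ : ℝ} (ha : 0 ≤ a) :
    ((certFamilies n κ).card : ℝ) ≤
      Real.exp (a * κ + Real.exp (-a) * (2 ^ n * (n + 1))) := by
  set Q : Finset (Finset (Fin n) × ℕ) := univ ×ˢ range (n + 1) with hQ
  have hQc : (Q.card : ℝ) = 2 ^ n * (n + 1) := by
    simp [hQ]
  have h1 : ((certFamilies n κ).card : ℝ) * Real.exp (-(a * κ)) ≤
      ∑ F ∈ Q.powerset, Real.exp (-a) ^ F.card := by
    calc ((certFamilies n κ).card : ℝ) * Real.exp (-(a * κ))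
        = ∑ _F ∈ certFamilies n κ, Real.exp (-(a * κ)) := by rw [sum_const, nsmul_eq_mul]
      _ ≤ ∑ F ∈ certFamilies n κ, Real.exp (-a) ^ F.card := by
          refine sum_le_sum fun F hF => ?_
          rw [← Real.exp_nat_mul]
          refine Real.exp_le_exp.2 ?_
          have := (mem_filter.1 hF).2
          nlinarith
      _ ≤ _ := sum_le_sum_of_subset_of_nonneg (filter_subset _ _) fun _ _ _ => by positivity
  have h2 : ∑ F ∈ Q.powerset, Real.exp (-a) ^ F.card = (Real.exp (-a) + 1) ^ Q.card := by
    rw [← sum_pow_mul_eq_add_pow]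
    simp
  have h3 : (Real.exp (-a) + 1) ^ Q.card ≤ Real.exp (Real.exp (-a) * Q.card) := by
    rw [mul_comm, Real.exp_nat_mul]
    exact pow_le_pow_left₀ (by positivity) (Real.add_one_le_exp _) _
  rw [h2] at h1
  rw [Real.exp_add, ← hQc]
  have h4 := h1.trans h3
  have h5 : Real.exp (-(a * κ)) = (Real.exp (a * κ))⁻¹ := Real.exp_neg _
  rw [h5, ← div_eq_mul_inv, div_le_iff₀ (Real.exp_pos _)] at h4
  linarith

/-- The estimate for ranks in the middle range: a matroid is determined by its rank, few
certificates, and a stable set. -/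
theorem ncard_matroidsOfRank_le_mul {n r s : ℕ} (hr2 : 2 ≤ r) (hrn : r < n) (hs : 1 ≤ s)
    (hs1 : 2 * s ≤ r) (hs2 : 2 * s ≤ n - r) {κ : ℝ}
    (hκ : 2 * (2 * Real.log n / ((r * (n - r : ℕ) : ℕ) / (2 * n.choose r)) + n.choose r / n ^ 2 +
        Real.log n / (((n - r) * (r + 1) : ℕ) / (2 * n.choose r)) +
        2 * n.choose r / (r + 1) / s + 2) ≤ κ) :
    (matroidsOfRank n r).ncard ≤ (certFamilies n κ).card * (stableSets n r).card := by
  rw [← card_product]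
  refine (ncard_matroidsOfRank_le_card
    ((certFamilies n κ ×ˢ stableSets n r).image fun p => decode r p.1 p.2) ?_).trans card_image_le
  rintro M ⟨hE, hr⟩
  have hn : Fintype.card (Fin n) = n := Fintype.card_fin n
  set K := nonbases M r with hKdef
  have hK : K ⊆ powersetCard r univ := nonbases_subset M r
  have hloc : ∀ X ∈ K, ∃ A B c, LocalCover r K X A B c :=
    fun X hX => exists_localCover M hE hr hr2 hX
  have hloc' : ∀ X, ∃ c, X ∈ K → ∃ A B, LocalCover r K X A B c := by
    intro X
    by_cases hX : X ∈ K
    · obtain ⟨A, B, c, h⟩ := hloc X hX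
      exact ⟨c, fun _ => ⟨A, B, h⟩⟩
    · exact ⟨∅, fun h => absurd h hX⟩
  choose c hc using hloc'
  obtain ⟨S, hSK, hSc, hdeg, hunc⟩ := exists_cover hn hK (by omega) hrn hs c hc
  have hFcard : ((S.biUnion c).card : ℝ) ≤ κ := by
    have h1 : (S.biUnion c).card ≤ S.card * 2 := card_biUnion_le_card_mul _ _ _ fun X hX => by
      obtain ⟨A, B, h⟩ := hc X (hSK hX)
      exact h.card_le
    have h2 : ((S.biUnion c).card : ℝ) ≤ S.card * 2 := by exact_mod_cast h1
    linarith
  have hFsub : S.biUnion c ⊆ univ ×ˢ range (n + 1) := biUnion_subset.2 fun X hX => by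
    obtain ⟨A, B, h⟩ := hc X (hSK hX)
    simpa using h.subset_univ
  have hsound : ∀ Z : Finset (Fin n), Z.card = r → CoveredBy (S.biUnion c) Z → Z ∈ K := by
    intro Z hZ h
    obtain ⟨v, hv, h⟩ := coveredBy_biUnion.1 h
    obtain ⟨A, B, h'⟩ := hc v (hSK hv)
    exact h'.sound Z hZ h
  obtain ⟨I, hIr, hI, hKI⟩ := exists_eq_decode hK hloc hsound hs1 (by rwa [hn])
    (by rwa [hn]) hunc
  exact mem_image.2 ⟨(S.biUnion c, I), mem_product.2
    ⟨mem_filter.2 ⟨mem_powerset.2 hFsub, hFcard⟩, mem_stableSets.2 ⟨hIr, hI⟩⟩, hKI.symm⟩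

/-! ### Asymptotics -/

theorem two_pow_mul_choose_le {n r : ℕ} (j : ℕ) (h : 3 * (r + j) ≤ n) :
    2 ^ j * n.choose r ≤ n.choose (r + j) := by
  induction j with
  | zero => simp
  | succ j ih =>
    have h1 := ih (by omega)
    have h2 := Nat.choose_succ_right_eq n (r + j)
    have h3 : n.choose (r + j) * (2 * (r + j + 1)) ≤ n.choose (r + j + 1) * (r + j + 1) := by
      rw [h2]
      exact Nat.mul_le_mul_left _ (by omega)
    have h4 : 2 * n.choose (r + j) ≤ n.choose (r + j + 1) := by
      refine Nat.le_of_mul_le_mul_right ?_ (Nat.succ_pos (r + j))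
      calc 2 * n.choose (r + j) * (r + j + 1) = n.choose (r + j) * (2 * (r + j + 1)) := by ring
        _ ≤ _ := h3
    calc 2 ^ (j + 1) * n.choose r = 2 * (2 ^ j * n.choose r) := by ring
      _ ≤ 2 * n.choose (r + j) := Nat.mul_le_mul_left _ h1
      _ ≤ _ := h4

/-- Far from the middle rank there are so few `r`-sets that the trivial bound `2 ^ n.choose r` on
the number of matroids is negligible. -/
theorem sq_mul_choose_le {n r : ℕ} (hn : n ^ 2 ≤ 2 ^ (n / 12)) (hr : r ≤ n)
    (h : 4 * r < n ∨ 3 * n < 4 * r) : n ^ 2 * n.choose r ≤ n.choose (n / 2) := by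
  have key : ∀ i, 4 * i < n → n ^ 2 * n.choose i ≤ n.choose (n / 2) := fun i hi =>
    (Nat.mul_le_mul_right _ hn).trans ((two_pow_mul_choose_le (n / 12) (by omega)).trans
      (Nat.choose_le_middle _ _))
  rcases h with h | h
  · exact key r h
  · rw [← Nat.choose_symm hr]
    exact key (n - r) (by omega)

theorem two_pow_le_mul_choose (n : ℕ) : 2 ^ n ≤ (n + 1) * n.choose (n / 2) := by
  rw [← Nat.sum_range_choose n]
  calc ∑ m ∈ range (n + 1), n.choose m ≤ ∑ _m ∈ range (n + 1), n.choose (n / 2) :=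
        sum_le_sum fun m _ => Nat.choose_le_middle m n
    _ = _ := by simp

theorem eventually_sq_le_two_pow : ∀ᶠ n : ℕ in atTop, n ^ 2 ≤ 2 ^ (n / 12) := by
  have h1 : ∀ᶠ k : ℕ in atTop, (k : ℝ) ^ 2 / 2 ^ k < 1 / 576 :=
    (tendsto_pow_const_div_const_pow_of_one_lt 2 (by norm_num : (1 : ℝ) < 2)).eventually
      (gt_mem_nhds (by norm_num))
  have h2 : Tendsto (fun n : ℕ => n / 12) atTop atTop := Nat.tendsto_div_const_atTop (by norm_num)
  filter_upwards [h2.eventually h1, eventually_ge_atTop 12] with n hn hn12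
  rw [div_lt_div_iff₀ (by positivity) (by norm_num)] at hn
  have h3 : (n / 12) ^ 2 * 576 < 1 * 2 ^ (n / 12) := by exact_mod_cast hn
  have h4 : n ≤ 24 * (n / 12) := by omega
  calc n ^ 2 ≤ (24 * (n / 12)) ^ 2 := Nat.pow_le_pow_left h4 2
    _ = (n / 12) ^ 2 * 576 := by ring
    _ ≤ _ := by omega

theorem eventually_cube_le_choose : ∀ᶠ n : ℕ in atTop, n ^ 3 ≤ n.choose (n / 2) := by
  have h1 : ∀ᶠ k : ℕ in atTop, (k : ℝ) ^ 4 / 2 ^ k < 1 / 2 :=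
    (tendsto_pow_const_div_const_pow_of_one_lt 4 (by norm_num : (1 : ℝ) < 2)).eventually
      (gt_mem_nhds (by norm_num))
  filter_upwards [h1, eventually_ge_atTop 1] with n hn hn1
  rw [div_lt_div_iff₀ (by positivity) (by norm_num)] at hn
  have h2 : n ^ 4 * 2 < 1 * 2 ^ n := by exact_mod_cast hn
  have h3 := two_pow_le_mul_choose n
  refine Nat.le_of_mul_le_mul_left ?_ (by omega : 0 < n + 1)
  calc (n + 1) * n ^ 3 ≤ (2 * n) * n ^ 3 := Nat.mul_le_mul_right _ (by omega)
    _ = n ^ 4 * 2 := by ring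
    _ ≤ _ := by omega

theorem one_le_log_natCast {n : ℕ} (hn : 3 ≤ n) : 1 ≤ Real.log n := by
  rw [Real.le_log_iff_exp_le (by positivity)]
  have h1 := Real.exp_one_lt_d9
  have h2 : (3 : ℝ) ≤ n := by exact_mod_cast hn
  linarith

/-- In the middle range of ranks, the number of certificates produced by `exists_cover` is
`O (N * log n / n ^ 2)`, where `N` is the central binomial coefficient. -/
theorem cover_size_le {n r : ℕ} (hn : 16 ≤ n) (hN : n ^ 3 ≤ n.choose (n / 2)) (h1 : n ≤ 4 * r)
    (h2 : 4 * r ≤ 3 * n) :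
    2 * (2 * Real.log n / ((r * (n - r : ℕ) : ℕ) / (2 * n.choose r)) + n.choose r / n ^ 2 +
        Real.log n / (((n - r) * (r + 1) : ℕ) / (2 * n.choose r)) +
        2 * n.choose r / (r + 1) / (n / 8 : ℕ) + 2) ≤
      1000 * (n.choose (n / 2) / n ^ 2 * Real.log n) := by
  have hlog := one_le_log_natCast (by omega : 3 ≤ n)
  set l := Real.log n
  have hn0 : (0 : ℝ) < n := by positivity
  have hN' : (n : ℝ) ^ 3 ≤ n.choose (n / 2) := by exact_mod_cast hN
  have hle : (n.choose r : ℝ) ≤ n.choose (n / 2) := by exact_mod_cast Nat.choose_le_middle r n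
  have hrpos : (0 : ℝ) < n.choose r := by exact_mod_cast Nat.choose_pos (by omega)
  set N : ℝ := ((n.choose (n / 2) : ℕ) : ℝ)
  set Nr : ℝ := ((n.choose r : ℕ) : ℝ)
  have hr4 : (n : ℝ) / 4 ≤ r := by
    have : (n : ℝ) ≤ 4 * r := by exact_mod_cast h1
    linarith
  have hd4 : (n : ℝ) / 4 ≤ (n - r : ℕ) := by
    have : (n : ℝ) ≤ 4 * (n - r : ℕ) := by exact_mod_cast (by omega : n ≤ 4 * (n - r))
    linarith
  have hs : (n : ℝ) / 16 ≤ (n / 8 : ℕ) := by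
    have : (n : ℝ) ≤ 16 * (n / 8 : ℕ) := by exact_mod_cast (by omega : n ≤ 16 * (n / 8))
    linarith
  have hNpos : 0 < N := hrpos.trans_le hle
  have hNn : 0 ≤ N / n ^ 2 := by positivity
  have hNl : N / n ^ 2 ≤ N / n ^ 2 * l := le_mul_of_one_le_right hNn hlog
  have hd : (n : ℝ) ^ 2 / 16 ≤ (r * (n - r : ℕ) : ℕ) := by
    push_cast
    calc (n : ℝ) ^ 2 / 16 = n / 4 * (n / 4) := by ring
      _ ≤ _ := by gcongr
  have hd' : (n : ℝ) ^ 2 / 16 ≤ ((n - r) * (r + 1) : ℕ) := by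
    refine hd.trans ?_
    exact_mod_cast (by rw [mul_comm]; exact Nat.mul_le_mul_left _ (Nat.le_succ r))
  have t1 : 2 * l / ((r * (n - r : ℕ) : ℕ) / (2 * Nr)) ≤ 64 * (N / n ^ 2 * l) := by
    calc 2 * l / ((r * (n - r : ℕ) : ℕ) / (2 * Nr)) ≤ 2 * l / (n ^ 2 / 16 / (2 * N)) := by gcongr
      _ = 64 * (N / n ^ 2 * l) := by field_simp; ring
  have t3 : l / (((n - r) * (r + 1) : ℕ) / (2 * Nr)) ≤ 32 * (N / n ^ 2 * l) := by
    calc l / (((n - r) * (r + 1) : ℕ) / (2 * Nr)) ≤ l / (n ^ 2 / 16 / (2 * N)) := by gcongr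
      _ = 32 * (N / n ^ 2 * l) := by field_simp; ring
  have t2 : Nr / n ^ 2 ≤ N / n ^ 2 := by gcongr
  have t4 : 2 * Nr / (r + 1) / (n / 8 : ℕ) ≤ 128 * (N / n ^ 2) := by
    calc 2 * Nr / (r + 1) / (n / 8 : ℕ) ≤ 2 * N / (n / 4) / (n / 16) := by
          gcongr
          linarith
      _ = 128 * (N / n ^ 2) := by field_simp; ring
  have t5 : 1 ≤ N / n ^ 2 := by
    rw [le_div_iff₀ (by positivity), one_mul]
    have : (1 : ℝ) ≤ n := by exact_mod_cast (by omega : 1 ≤ n)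
    nlinarith [sq_nonneg (n : ℝ)]
  linarith

theorem ncard_matroidsOfRank_le {n r : ℕ} (hn : 16 ≤ n) (hN : n ^ 3 ≤ n.choose (n / 2))
    (hn2 : n ^ 2 ≤ 2 ^ (n / 12)) (hr : r ≤ n) (hs : 1 ≤ numSparsePaving n) :
    ((matroidsOfRank n r).ncard : ℝ) ≤
      Real.exp (n.choose (n / 2) / n ^ 2 * (4000 * Real.log n ^ 2 + 4)) * numSparsePaving n := by
  have hn0 : (0 : ℝ) < n := by positivity
  have hs' : (1 : ℝ) ≤ numSparsePaving n := by exact_mod_cast hs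
  by_cases h : 4 * r < n ∨ 3 * n < 4 * r
  · have h1 : (n : ℝ) ^ 2 * n.choose r ≤ n.choose (n / 2) := by
      exact_mod_cast sq_mul_choose_le hn2 hr h
    have h2 : ((matroidsOfRank n r).ncard : ℝ) ≤ 2 ^ n.choose r := by
      exact_mod_cast ncard_matroidsOfRank_le_two_pow n r
    calc ((matroidsOfRank n r).ncard : ℝ) ≤ 2 ^ n.choose r := h2
      _ ≤ Real.exp 1 ^ n.choose r := by
          gcongr
          have := Real.add_one_le_exp 1
          linarith
      _ = Real.exp (n.choose r) := by rw [← Real.exp_nat_mul, mul_one]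
      _ ≤ Real.exp (n.choose (n / 2) / n ^ 2 * (4000 * Real.log n ^ 2 + 4)) := by
          refine Real.exp_le_exp.2 ?_
          calc (n.choose r : ℝ) ≤ n.choose (n / 2) / n ^ 2 := by
                rw [le_div_iff₀ (by positivity)]; linarith
            _ ≤ _ := le_mul_of_one_le_right (by positivity) (by nlinarith [sq_nonneg (Real.log n)])
      _ ≤ _ := le_mul_of_one_le_right (by positivity) hs'
  · push Not at h
    set κ : ℝ := 1000 * (n.choose (n / 2) / n ^ 2 * Real.log n) with hκ
    have h1 := ncard_matroidsOfRank_le_mul (s := n / 8) (by omega) (by omega) (by omega) (by omega)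
      (by omega) (cover_size_le hn hN h.1 h.2)
    have h2 : (stableSets n r).card ≤ numSparsePaving n :=
      card_stableSets_le (by omega) (by omega)
    have h3 : ((matroidsOfRank n r).ncard : ℝ) ≤ (certFamilies n κ).card * numSparsePaving n := by
      rw [← Nat.cast_mul]
      exact Nat.cast_le.2 (h1.trans (Nat.mul_le_mul_left _ h2))
    refine h3.trans (mul_le_mul_of_nonneg_right ?_ (by positivity))
    have hl : 0 ≤ Real.log n := Real.log_natCast_nonneg n
    -- with `a = 4 log n`, the at most `2 ^ n * (n + 1)` certificates contribute only `O (N / n ^ 2)`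
    refine (card_certFamilies_le n (a := 4 * Real.log n) (by positivity)).trans
      (Real.exp_le_exp.2 ?_)
    have h4 : Real.exp (-(4 * Real.log n)) = 1 / n ^ 4 := by
      rw [Real.exp_neg, show (4 : ℝ) * Real.log n = (4 : ℕ) * Real.log n by norm_num,
        Real.exp_nat_mul, Real.exp_log hn0, one_div]
    have h5 : (2 : ℝ) ^ n ≤ (n + 1) * n.choose (n / 2) := by
      exact_mod_cast two_pow_le_mul_choose n
    have hn1 : (1 : ℝ) ≤ n := by exact_mod_cast (by omega : 1 ≤ n)
    have h6 : 1 / (n : ℝ) ^ 4 * (2 ^ n * (n + 1)) ≤ n.choose (n / 2) / n ^ 2 * 4 := by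
      calc 1 / (n : ℝ) ^ 4 * (2 ^ n * (n + 1))
          ≤ 1 / (n : ℝ) ^ 4 * (((n + n) * n.choose (n / 2)) * (n + n)) := by
            gcongr
            exact h5.trans (by gcongr)
        _ = _ := by field_simp; ring
    rw [h4, hκ]
    linarith

/-- The error term `N / n ^ 2 * (4000 * log n ^ 2 + 5)` is compared with the lower bound
`log s_n ≥ N / n * log 2`. -/
theorem log_numLooplessColoopless_le {n : ℕ} (hn : 16 ≤ n) (hN : n ^ 3 ≤ n.choose (n / 2))
    (hn2 : n ^ 2 ≤ 2 ^ (n / 12)) :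
    Real.log (numLooplessColoopless n) ≤
      (1 + (4000 * Real.log n ^ 2 + 5) / (n * Real.log 2)) * Real.log (numSparsePaving n) := by
  have hn0 : (0 : ℝ) < n := by positivity
  have hlog2 : 0 < Real.log 2 := Real.log_pos one_lt_two
  have hlow := le_log_numSparsePaving (n := n) (r := n / 2) (by omega) (by omega)
  have hNpos : (0 : ℝ) < n.choose (n / 2) := by exact_mod_cast Nat.choose_pos (Nat.div_le_self _ _)
  set N : ℝ := ((n.choose (n / 2) : ℕ) : ℝ) with hNdef
  have hlogpos : 0 < Real.log (numSparsePaving n) := lt_of_lt_of_le (by positivity) hlow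
  have hs : 1 ≤ numSparsePaving n := by
    by_contra h
    have : numSparsePaving n = 0 := by omega
    rw [this] at hlogpos
    simp at hlogpos
  have hs' : (0 : ℝ) < numSparsePaving n := by exact_mod_cast hs
  set δ : ℝ := N / n ^ 2 * (4000 * Real.log n ^ 2 + 4) with hδ
  rcases Nat.eq_zero_or_pos (numLooplessColoopless n) with h0 | hpos
  · -- `Real.log 0 = 0`, and the right-hand side is nonnegative
    rw [h0, Nat.cast_zero, Real.log_zero]
    positivity
  have h1 : (numLooplessColoopless n : ℝ) ≤ (n + 1) * (Real.exp δ * numSparsePaving n) := by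
    calc (numLooplessColoopless n : ℝ) ≤ ∑ r ∈ range (n + 1), ((matroidsOfRank n r).ncard : ℝ) := by
          exact_mod_cast numLooplessColoopless_le n
      _ ≤ ∑ _r ∈ range (n + 1), Real.exp δ * numSparsePaving n :=
          sum_le_sum fun r hr => ncard_matroidsOfRank_le hn hN hn2
            (Nat.lt_succ_iff.1 (mem_range.1 hr)) hs
      _ = _ := by simp
  have h2 : Real.log (numLooplessColoopless n) ≤
      Real.log (n + 1) + (δ + Real.log (numSparsePaving n)) := by
    have h := Real.log_le_log (by exact_mod_cast hpos) h1
    rwa [Real.log_mul (by positivity) (by positivity), Real.log_mul (Real.exp_pos _).ne' hs'.ne',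
      Real.log_exp] at h
  have h3 : Real.log (n + 1) ≤ N / n ^ 2 := by
    have h4 := Real.log_le_sub_one_of_pos (show (0 : ℝ) < n + 1 by positivity)
    have h5 : (n : ℝ) ^ 3 ≤ N := by rw [hNdef]; exact_mod_cast hN
    have h6 : (n : ℝ) ≤ N / n ^ 2 := by
      rw [le_div_iff₀ (by positivity)]
      calc (n : ℝ) * n ^ 2 = n ^ 3 := by ring
        _ ≤ N := h5
    linarith
  have h4 : N / n ^ 2 * (4000 * Real.log n ^ 2 + 5) ≤
      (4000 * Real.log n ^ 2 + 5) / (n * Real.log 2) * Real.log (numSparsePaving n) := by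
    calc N / n ^ 2 * (4000 * Real.log n ^ 2 + 5)
        = (4000 * Real.log n ^ 2 + 5) / (n * Real.log 2) * (N / n * Real.log 2) := by
          field_simp
      _ ≤ _ := by gcongr
  rw [one_add_mul]
  linarith

theorem tendsto_log_sq_div :
    Tendsto (fun n : ℕ => (4000 * Real.log n ^ 2 + 5) / (n * Real.log 2)) atTop (𝓝 0) := by
  have h1 : Tendsto (fun x : ℝ => Real.log x ^ 2 / x) atTop (𝓝 0) := by
    simpa using Real.tendsto_pow_log_div_mul_add_atTop 1 0 2 one_ne_zero
  have h2 : Tendsto (fun x : ℝ => 4000 / Real.log 2 * (Real.log x ^ 2 / x) + 5 / Real.log 2 * x⁻¹)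
      atTop (𝓝 0) := by
    simpa using (h1.const_mul (4000 / Real.log 2)).add
      (tendsto_inv_atTop_zero.const_mul (5 / Real.log 2))
  refine (h2.comp tendsto_natCast_atTop_atTop).congr' ?_
  filter_upwards [eventually_gt_atTop 0] with n hn
  have hn0 : (n : ℝ) ≠ 0 := by positivity
  have hlog2 : Real.log 2 ≠ 0 := (Real.log_pos one_lt_two).ne'
  simp only [Function.comp]
  field_simp

end MatroidCount

theorem mainTheorem2 :
    ∃ ε : ℕ → ℝ, Tendsto ε atTop (𝓝 0) ∧
      ∀ᶠ n : ℕ in atTop,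
        Real.logb 2 (numLooplessColoopless n : ℝ) ≤
          (1 + ε n) * Real.logb 2 (numSparsePaving n : ℝ) := by
  refine ⟨_, MatroidCount.tendsto_log_sq_div, ?_⟩
  filter_upwards [eventually_ge_atTop 16, MatroidCount.eventually_cube_le_choose,
    MatroidCount.eventually_sq_le_two_pow] with n hn hN hn2
  have hlog2 : 0 < Real.log 2 := Real.log_pos one_lt_two
  rw [Real.logb, Real.logb, ← mul_div_assoc, div_le_div_iff_of_pos_right hlog2]
  exact MatroidCount.log_numLooplessColoopless_le hn hN hn2
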